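/- **Setting.** Agents $1,\dots,n$ minimise $f=\frac1n\sum_{i=1}^n f_i$ over $\mathbb R^d$ ($d\ge1$), where each $f_i:\mathbb R^d\to\mathbb R$ is differentiable with $\|\nabla f_i(x)-\nabla f_i(y)\|\le \ell\|x-y\|$ for all $x,y$ ($\ell>0$), $f^*=\inf f>-\infty$, and a number $f_{\rm low}\le f^*$ is known. The network is an undirected connected graph on the agents with symmetric weights $A_{ij}\ge 0$ and Laplacian $L=\mathrm{diag}(\sum_jA_{ij})-A$; let $\rho$ be the spectral radius and $\rho_2$ the smallest positive eigenvalue of $L$ (so $n\ge2$). For some $p\in[1,\infty]$, $r,C>0$, $\delta\in(0,1]$, the compressor $\mathcal C:\mathbb R^d\to\mathbb R^d$ satisfies $\|\mathcal C(x)/r-x\|_p\le C(1-\delta)$ whenever $\|x\|_p\le C$. Put $\hat d=d^{1/p-1/2},\ \tilde d=1$ if $p\le2$ and $\hat d=1,\ \tilde d=d^{1/2-1/p}$ if $p>2$. **Algorithm.** With parameters $\alpha,\beta,\gamma,\omega>0$ and $s_k>0$, starting from $x_{i,0}\in\mathbb R^d$, $v_{i,0}=0$, iterate for $k=0,1,\dots$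 $$q_{i,k}=\mathcal C\big((x_{i,k}-\hat x_{i,k-1})/s_k\big),\quad \hat x_{i,k}=\hat x_{i,k-1}+\omega s_kq_{i,k},\quad y_{i,k}=y_{i,k-1}+\omega s_k\sum_jL_{ij}q_{j,k},$$ $$x_{i,k+1}=x_{i,k}-\alpha(\beta y_{i,k}+\gamma v_{i,k}+\nabla f_i(x_{i,k})),\quad v_{i,k+1}=v_{i,k}+\alpha\gamma y_{i,k}.$$ The first communication round is uncompressed: either the agents exchange $x_{i,0}$ exactly beforehand, so that $\hat x_{i,-1}=x_{i,0}$ and $y_{i,-1}=\sum_jL_{ij}x_{j,0}$; or the exact exchange replaces the compressed one of iteration $0$, so that $\hat x_{i,0}=x_{i,0}$ and $y_{i,0}=\sum_jL_{ij}x_{j,0}$. Write $\bar x_k=\frac1n\sum_ix_{i,k}$. **Constants.** Put $\beta=\tau_1\gamma$, $\varepsilon_1=\frac{\tau_1\rho_2-1}{2\tau_1\rho_2}$, $\varepsilon_5=\omega r(\delta-\delta^2/2)$, $\varepsilon_8=(\varepsilon_5+2\varepsilon_5^2)/2$, and $$\varphi_1=\tfrac12(\rho_2\beta-3\gamma-2-2\ell^2),\quad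 \varphi_2=3\rho^2\beta^2-\rho_2\beta\gamma+(\rho+2)\gamma^2+1+\tfrac52\ell^2,\quad \varphi_3=\tfrac\gamma2-\tfrac{5}{2\rho_2},\quad \varphi_4=2\rho\gamma^2+\tfrac12\rho,$$ $$\varphi_5=\tfrac18-\tfrac{(\beta+\gamma)^2\ell^2}{\gamma^5\rho_2}-\tfrac{\ell^2}{2\gamma^2\rho_2^2},\quad \varphi_6=\tfrac{(\beta+\gamma)\ell^2}{2\gamma^3\rho_2}+\tfrac{\ell^2}{2\gamma^2\rho_2^2}+\tfrac{\ell^2}{2\rho_2^2}+\tfrac{\ell^2}2+\tfrac\ell2,$$ $$\varphi_7=(\rho+1)\gamma+\tfrac12\rho\beta,\quad \varphi_8=3\rho^2\beta^2+(\rho-2\rho_2)\beta\gamma+(\rho+2)\gamma^2+1,\quad \psi_2=\varphi_7+\alpha\varphi_8,$$ $$\psi_3=4(1+\varepsilon_5^{-1})\hat d^2\beta^2\rho^2,\quad \psi_4=4(1+\varepsilon_5^{-1})\hat d^2\max\{\beta^2\rho^2+\ell^2,\gamma^2\rho\}/\varepsilon_1,$$ $$\hat\kappa_0=\min\{\tfrac{\varphi_1}{\varphi_2},\tfrac{\varphi_3}{\varphi_4},\tfrac{\varphi_5}{\varphi_6}\},\quad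 \kappa_7=\min\{\hat\kappa_0,\tfrac1{2\ell}\},\quad \kappa_1=\tfrac4{\rho_2},\quad \kappa_2=\max\Big\{2+2\ell^2,\tfrac5{\rho_2},\sqrt[3]{\tfrac{16\ell^2(\kappa_1+1)^2}{\rho_2}},\tfrac{2\sqrt2\,\ell}{\rho_2}\Big\},$$ $$\kappa_0=\Big(\tfrac{\varepsilon_8}{2(1-2\varepsilon_5)\psi_2\psi_4}\Big)^{1/3}\ (=\infty\text{ if }\varepsilon_5=\tfrac12),\quad \kappa_3=\max\Big\{\tfrac{\tau_0^3}{n\tilde d^2\kappa_7^3},\Big(\tfrac{(1-2\varepsilon_5)\psi_3\tau_0^2}{\varepsilon_8}\Big)^{3/2}n^{1/2}\tilde d\Big\},$$ $$\kappa_4=\frac{2\psi_4\mathcal L_0}{C^2\varepsilon_8n},\qquad \tilde\kappa_4(T)=\psi_4\mathcal L_0\alpha^2/C^2+(1-2\varepsilon_5)\psi_2\psi_4n\tilde d^2s_0^2\alpha^3T.$$ Here $\mathcal L_0=\frac12\|\boldsymbol x_0\|_{\boldsymbol E}^2+\frac{\beta+\gamma}{2\gamma}\|\boldsymbol w_0\|_{\boldsymbol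 F}^2+\boldsymbol x_0^\top\boldsymbol E\boldsymbol F\boldsymbol w_0+n(f(\bar x_0)-f_{\rm low})$, where $\boldsymbol x_0$ stacks the $x_{i,0}$, $\boldsymbol w_0$ stacks the $\frac1\gamma\nabla f_i(\bar x_0)$, $\boldsymbol E=(I-\frac1n\mathbf 1\mathbf 1^\top)\otimes I_d$ and $\boldsymbol F=(L+\frac{\lambda}{n}\mathbf 1\mathbf 1^\top)^{-1}\otimes I_d$ for some fixed $\lambda\in[\rho_2,\rho]$. **Theorem.** Let $\tau_1\ge\kappa_1$, $\gamma>\kappa_2$, $\hat\kappa_0>0$, $\omega\in(0,1/r]$, $\tau_0,\tau_4>0$. There is a constant $M$, depending only on $\ell,\rho,\rho_2,\hat d,C,r,\delta,\gamma,\omega,\tau_0,\tau_1,\tau_4$ (in particular not on $n$, $\tilde d$, $T$), such that the following holds for all problems as above with these values. If $T>\kappa_3$ is an integer, $$\alpha=\frac{\tau_0}{n^{1/3}\tilde d^{2/3}T^{1/3}},\quad \beta=\tau_1\gamma,\quad s_0^2=\tau_4n\alpha^2,\quad s_k^2=(1-\varepsilon_8)s_{k-1}^2+\tilde\kappa_4(T)\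 (1\le k\le T),\quad \tau_0\le\kappa_0,\quad \tau_4\ge\kappa_4,$$ then the iterates of the algorithm with an uncompressed first round satisfy $$\frac1T\sum_{k=0}^{T-1}\Big(\|\nabla f(\bar x_k)\|^2+\frac1n\sum_{i=1}^n\|x_{i,k}-\bar x_k\|^2\Big)\le M\,\frac{n^{1/3}\tilde d^{2/3}}{T^{2/3}},\qquad f(\bar x_T)-f^*\le M .$$ -/

import Mathlib

open scoped Gradient InnerProductSpace ENNReal

noncomputable section

namespace CompressedOpt

/-- `ℝ^d` with its Euclidean norm. -/
abbrev Vec (d : ℕ) : Type := EuclideanSpace ℝ (Fin d)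

/-- The `ℓ_p` norm of a vector, `1 ≤ p ≤ ∞`. -/
def lpNorm (p : ℝ≥0∞) {d : ℕ} (x : Vec d) : ℝ := ‖WithLp.toLp p (WithLp.ofLp x)‖

/-- `d̂`, with `‖x‖_p ≤ d̂ ‖x‖₂` (here `1/∞ = 0`). -/
def dHat (p : ℝ≥0∞) (d : ℕ) : ℝ :=
  if p ≤ 2 then (d : ℝ) ^ ((p⁻¹).toReal - 1 / 2) else 1

/-- `d̃`, with `‖x‖₂ ≤ d̃ ‖x‖_p` (here `1/∞ = 0`). -/
def dTilde (p : ℝ≥0∞) (d : ℕ) : ℝ :=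
  if p ≤ 2 then 1 else (d : ℝ) ^ (1 / 2 - (p⁻¹).toReal)

/-- A locally-bounded compressor: on the `ℓ_p` ball of radius `C` the map `comp / r` deviates from
the identity by at most `C (1 - δ)` in the `ℓ_p` norm. -/
def LocallyBounded (p : ℝ≥0∞) {d : ℕ} (C r δ : ℝ) (comp : Vec d → Vec d) : Prop :=
  ∀ x : Vec d, lpNorm p x ≤ C → lpNorm p ((1 / r) • comp x - x) ≤ C * (1 - δ)

/-! ### The network -/

/-- `A` is the weighted adjacency matrix of an undirected connected graph on `Fin n`
(the edges are the pairs with a positive weight). -/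
structure IsConnectedNetwork {n : ℕ} (A : Matrix (Fin n) (Fin n) ℝ) : Prop where
  nonneg : ∀ i j, 0 ≤ A i j
  symm : ∀ i j, A i j = A j i
  connected : (SimpleGraph.fromRel (fun i j => 0 < A i j)).Connected

/-- The graph Laplacian `L = D - A`. -/
def laplacian {n : ℕ} (A : Matrix (Fin n) (Fin n) ℝ) : Matrix (Fin n) (Fin n) ℝ :=
  Matrix.diagonal (fun i => ∑ j, A i j) - A

/-- The averaging matrix `q qᵀ` with `q = 1/√n`. -/
def avgMatrix (n : ℕ) : Matrix (Fin n) (Fin n) ℝ := fun _ _ => 1 / (n : ℝ)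

/-- `E = I - q qᵀ`. -/
def matE (n : ℕ) : Matrix (Fin n) (Fin n) ℝ := 1 - avgMatrix n

/-- `F = [q Q] diag(lam⁻¹, Λ⁻¹) [q Q]ᵀ`, where `L = [q Q] diag(0, Λ) [q Q]ᵀ`; equivalently, the
inverse of `L + lam q qᵀ = [q Q] diag(lam, Λ) [q Q]ᵀ`. -/
def matF {n : ℕ} (A : Matrix (Fin n) (Fin n) ℝ) (lam : ℝ) : Matrix (Fin n) (Fin n) ℝ :=
  (laplacian A + lam • avgMatrix n)⁻¹

/-- `uᵀ (M ⊗ I_d) w` for stacked vectors `u`, `w`. -/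
def bilin {n d : ℕ} (M : Matrix (Fin n) (Fin n) ℝ) (u w : Fin n → Vec d) : ℝ :=
  ∑ i, ∑ j, M i j * ⟪u i, w j⟫_ℝ

/-- `(M ⊗ I_d) u` for a stacked vector `u`. -/
def applyMat {n d : ℕ} (M : Matrix (Fin n) (Fin n) ℝ) (u : Fin n → Vec d) : Fin n → Vec d :=
  fun i => ∑ j, M i j • u j

/-- The average `x̄` of the agents' vectors. -/
def mean {n d : ℕ} (x : Fin n → Vec d) : Vec d := (1 / (n : ℝ)) • ∑ i, x i

/-- The global cost `f = (1/n) ∑ f_i`. -/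
def globalCost {n d : ℕ} (f : Fin n → Vec d → ℝ) : Vec d → ℝ :=
  fun x => (1 / (n : ℝ)) * ∑ i, f i x

/-! ### Scalar parameters and derived constants -/

/-- The scalars on which the constants of the convergence result depend. -/
structure Params where
  /-- smoothness constant of the local costs -/
  ell : ℝ
  /-- spectral radius of the Laplacian -/
  rho : ℝ
  /-- smallest positive eigenvalue of the Laplacian -/
  rho2 : ℝ
  /-- the constant `d̂` -/
  dhat : ℝ
  /-- radius of the local region of the compressor -/
  C : ℝ
  /-- scaling of the compressor -/
  r : ℝ
  /-- contraction factor of the compressor -/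
  del : ℝ
  /-- algorithm parameter `γ` -/
  gam : ℝ
  /-- algorithm parameter `ω` -/
  om : ℝ
  /-- stepsize factor `τ₀` -/
  tau0 : ℝ
  /-- ratio `τ₁ = β / γ` -/
  tau1 : ℝ
  /-- factor `τ₄` of the initial scaling -/
  tau4 : ℝ

namespace Params

variable (c : Params)

def beta : ℝ := c.tau1 * c.gam

def eps1 : ℝ := (c.tau1 * c.rho2 - 1) / (2 * c.tau1 * c.rho2)

def eps5 : ℝ := c.om * c.r * (c.del - c.del ^ 2 / 2)

def eps8 : ℝ := (c.eps5 + 2 * c.eps5 ^ 2) / 2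

def phi1 : ℝ := (1 / 2) * (c.rho2 * c.beta - (3 * c.gam + 2 + 2 * c.ell ^ 2))

def phi2 : ℝ :=
  3 * c.rho ^ 2 * c.beta ^ 2 - c.rho2 * c.beta * c.gam + (c.rho + 2) * c.gam ^ 2
    + 1 + (5 / 2) * c.ell ^ 2

def phi3 : ℝ := c.gam / 2 - (5 / 2) * c.rho2⁻¹

def phi4 : ℝ := 2 * c.rho * c.gam ^ 2 + (1 / 2) * c.rho

def phi5 : ℝ :=
  1 / 8 - (c.beta + c.gam) ^ 2 / c.gam ^ 5 * c.rho2⁻¹ * c.ell ^ 2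
    - 1 / (2 * c.gam ^ 2) * (c.rho2⁻¹) ^ 2 * c.ell ^ 2

def phi6 : ℝ :=
  (c.beta + c.gam) / (2 * c.gam ^ 3) * c.rho2⁻¹ * c.ell ^ 2
    + 1 / (2 * c.gam ^ 2) * (c.rho2⁻¹) ^ 2 * c.ell ^ 2
    + (c.rho2⁻¹) ^ 2 / 2 * c.ell ^ 2 + c.ell ^ 2 / 2 + c.ell / 2

def phi7 : ℝ := (c.rho + 1) * c.gam + (1 / 2) * c.rho * c.beta

def phi8 : ℝ :=
  3 * c.rho ^ 2 * c.beta ^ 2 + (c.rho - 2 * c.rho2) * c.beta * c.gam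
    + (c.rho + 2) * c.gam ^ 2 + 1

/-- `ψ₂`, which depends on the stepsize `α`. -/
def psi2 (α : ℝ) : ℝ := c.phi7 + α * c.phi8

def psi3 : ℝ := 4 * (1 + c.eps5⁻¹) * c.dhat ^ 2 * c.beta ^ 2 * c.rho ^ 2

def psi4 : ℝ :=
  4 * (1 + c.eps5⁻¹) * c.dhat ^ 2
    * max (c.beta ^ 2 * c.rho ^ 2 + c.ell ^ 2) (c.gam ^ 2 * c.rho) / c.eps1

def kappaHat0 : ℝ := min (c.phi1 / c.phi2) (min (c.phi3 / c.phi4) (c.phi5 / c.phi6))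

def kappa1 : ℝ := 4 / c.rho2

def kappa2 : ℝ :=
  max (2 + 2 * c.ell ^ 2)
    (max (5 / c.rho2)
      (max ((16 * c.ell ^ 2 * (c.kappa1 + 1) ^ 2 / c.rho2) ^ (1 / 3 : ℝ))
        (2 * √2 * c.ell / c.rho2)))

def kappa7 : ℝ := min c.kappaHat0 (1 / (2 * c.ell))

/-- The stepsize `α = τ₀ / (n^{1/3} d̃^{2/3} T^{1/3})`. -/
def stepsize (n : ℕ) (dt : ℝ) (T : ℕ) : ℝ :=
  c.tau0 / ((n : ℝ) ^ (1 / 3 : ℝ) * dt ^ (2 / 3 : ℝ) * (T : ℝ) ^ (1 / 3 : ℝ))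

/-- `τ₀ ≤ κ₀` for `κ₀ = (ε₈ / (2 (1 - 2 ε₅) ψ₂ ψ₄))^{1/3}`, with the denominator cleared, so that
`κ₀ = ∞` (no restriction) when `1 - 2 ε₅ = 0`. -/
def Tau0LeKappa0 (α : ℝ) : Prop :=
  2 * (1 - 2 * c.eps5) * c.psi2 α * c.psi4 * c.tau0 ^ 3 ≤ c.eps8

def kappa3 (n : ℕ) (dt : ℝ) : ℝ :=
  max (c.tau0 ^ 3 / ((n : ℝ) * dt ^ 2 * c.kappa7 ^ 3))
    (((1 - 2 * c.eps5) * c.psi3 * c.tau0 ^ 2 / c.eps8) ^ (3 / 2 : ℝ)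
      * (n : ℝ) ^ (1 / 2 : ℝ) * dt)

/-- `κ₄`, where `V0` is the initial value of the Lyapunov function. -/
def kappa4 (n : ℕ) (V0 : ℝ) : ℝ := 2 * c.psi4 * V0 / (c.C ^ 2 * c.eps8 * n)

/-- The increment `κ̃₄(T)` of the recursion for `s_k²`; `V0` is the initial value of the Lyapunov
function, `s0` the initial scaling factor and `α` the stepsize. -/
def kappaTilde4 (n : ℕ) (dt V0 s0 α : ℝ) (T : ℕ) : ℝ :=
  c.psi4 * V0 * α ^ 2 / c.C ^ 2
    + (1 - 2 * c.eps5) * c.psi2 α * c.psi4 * n * dt ^ 2 * s0 ^ 2 * α ^ 3 * T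

/-- The Lyapunov function (consensus error, dual term, cross term and optimality gap) at primal
variables `x` and dual variables `v`, with the gap measured from the lower bound `flow`. -/
def lyapunov {n d : ℕ} (A : Matrix (Fin n) (Fin n) ℝ) (lam : ℝ) (f : Fin n → Vec d → ℝ)
    (flow : ℝ) (x v : Fin n → Vec d) : ℝ :=
  let w : Fin n → Vec d := fun i => v i + (1 / c.gam) • ∇ (f i) (mean x)
  (1 / 2) * bilin (matE n) x x
    + (1 / 2) * ((c.beta + c.gam) / c.gam) * bilin (matF A lam) w w
    + bilin (matE n * matF A lam) x w
    + n * (globalCost f (mean x) - flow)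

end Params

/-! ### The algorithm -/

/-- The variables of all agents at the start of iteration `k`:
`x_k`, `v_k`, `x̂_{k-1}` and `y_{k-1}`. -/
structure State (n d : ℕ) where
  x : Fin n → Vec d
  v : Fin n → Vec d
  xhat : Fin n → Vec d
  y : Fin n → Vec d

namespace State

variable {n d : ℕ}

/-- The primal and dual updates, once `x̂_k = xhat` and `y_k = y` have been computed. -/
def update (c : Params) (α : ℝ) (f : Fin n → Vec d → ℝ) (z : State n d)
    (xhat y : Fin n → Vec d) : State n d where
  x := fun i => z.x i - α • (c.beta • y i + c.gam • z.v i + ∇ (f i) (z.x i))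
  v := fun i => z.v i + (α * c.gam) • y i
  xhat := xhat
  y := y

/-- The compressed messages `q_k`. -/
def message (comp : Vec d → Vec d) (s : ℝ) (z : State n d) : Fin n → Vec d :=
  fun i => comp ((1 / s) • (z.x i - z.xhat i))

/-- One iteration of the algorithm with scaling factor `s`. -/
def step (c : Params) (A : Matrix (Fin n) (Fin n) ℝ) (α : ℝ) (f : Fin n → Vec d → ℝ)
    (comp : Vec d → Vec d) (s : ℝ) (z : State n d) : State n d :=
  z.update c α f
    (fun i => z.xhat i + (c.om * s) • z.message comp s i)
    (fun i => z.y i + (c.om * s) • applyMat (laplacian A) (z.message comp s) i)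

/-- The initialization of the algorithm. -/
def coldStart (x0 : Fin n → Vec d) : State n d where
  x := x0
  v := 0
  xhat := 0
  y := 0

/-- The initialization after an exact exchange of the initial vectors:
`x̂_{-1} = x_0` and `y_{-1} = L x_0`. -/
def warmStart (A : Matrix (Fin n) (Fin n) ℝ) (x0 : Fin n → Vec d) : State n d where
  x := x0
  v := 0
  xhat := x0
  y := applyMat (laplacian A) x0

/-- `z` is a run of the algorithm from `x0` with one initial uncompressed communication round.
Both implementations of that round are admitted: either the agents first exchange `x_0` exactly,
so that `x̂_{-1} = x_0`, `y_{-1} = L x_0`, and then iterate; or the exact exchange takes the place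
of the compressed exchange of iteration `0`, so that `x̂_0 = x_0`, `y_0 = L x_0`. -/
def IsRunWithExactFirstRound (c : Params) (A : Matrix (Fin n) (Fin n) ℝ) (α : ℝ)
    (f : Fin n → Vec d → ℝ) (comp : Vec d → Vec d) (s : ℕ → ℝ) (x0 : Fin n → Vec d)
    (z : ℕ → State n d) : Prop :=
  ((z 0 = warmStart A x0 ∧ z 1 = (z 0).step c A α f comp (s 0)) ∨
    (z 0 = coldStart x0 ∧ z 1 = (z 0).update c α f x0 (applyMat (laplacian A) x0))) ∧
  ∀ k, 1 ≤ k → z (k + 1) = (z k).step c A α f comp (s k)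

end State

end CompressedOpt

end

/-! The proof couples two mechanisms. Since the first round is exact and `L` is linear, `y_k = L
x̂_k` throughout, so an iteration is an uncompressed primal-dual step perturbed by the compression
error `e_k = x_k - x̂_k`.

Descent. On stacked vectors put `K = L + lam J` with `J` the averaging matrix, `E = I - J`, `F =
K⁻¹`; then `L = K E`. With `w = v + ∇f(x̄)/γ` the Lyapunov function is the quadratic `energy` of
`(x, w)` plus `n` times the optimality gap. The dual weight `(β+γ)/γ` makes the primal-dual coupling
cancel up to `e`, and the cross term supplies dissipation in `w`. The dual variables have mean zero,
so `x̄` does inexact gradient descent. Adding the descent lemma gives `V_{k+1} ≤ V_k - α · progress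
+ α ψ₂ ‖e_k‖²` (`IsNetworkTriple.energy_step_le`, `lyapunov_update_le`).

Compression. If the innovation `x_k - x̂_{k-1}` has `ℓ_p` norm at most `C s_k`, compression leaves
squared error at most `C² s_k² (1 - 2ε₅)` (`lpNorm_compress_sq_le`). The next innovation is `e_k`
plus the displacement `x_{k+1} - x_k`, and the displacement is bounded through `V_k`
(`movement_le`). The recursion for `s_k` is designed so that this fits in the next ball, provided
`V_k ≤ V_0 + T R`, where `R` bounds the error input of one iteration. `run_bounds` proves the two
statements by a joint induction.

Scaling. Because `α³ n d̃² T = τ₀³`, the conditions on `τ₀` and `τ₄` give `s_k ≤ s_0` and `V_0 + T R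
≤ n · level`, with `level` free of `n`, `d̃`, `T`. Telescoping the descent and dividing by `n α T`
gives the rate; the last Lyapunov value bounds the gap. -/

open scoped Gradient InnerProductSpace ENNReal

noncomputable section

namespace CompressedOpt

/-! ### The operators of the network on an abstract inner product space -/

section Operators

variable {H : Type*} [NormedAddCommGroup H] [InnerProductSpace ℝ H]

/-- `E` is an orthogonal projection that commutes with the symmetric operator `K`, whose quadratic
form lies between `lo` and `hi` and which acts as `lam` on the kernel of `E`; `F = K⁻¹`. -/
structure IsNetworkTriple (E K F : H →ₗ[ℝ] H) (lo hi lam : ℝ) : Prop where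
  symmE : ∀ x y, ⟪E x, y⟫_ℝ = ⟪x, E y⟫_ℝ
  idemE : ∀ x, E (E x) = E x
  symmK : ∀ x y, ⟪K x, y⟫_ℝ = ⟪x, K y⟫_ℝ
  comm : ∀ x, E (K x) = K (E x)
  right_inv : ∀ x, K (F x) = x
  left_inv : ∀ x, F (K x) = x
  lower : ∀ x, lo * ‖x‖ ^ 2 ≤ ⟪x, K x⟫_ℝ
  upper : ∀ x, ⟪x, K x⟫_ℝ ≤ hi * ‖x‖ ^ 2
  consensus : ∀ x, K (x - E x) = lam • (x - E x)

/-- The quadratic part of the Lyapunov function, `k` being the weight of the dual term. -/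
def energy (E F : H →ₗ[ℝ] H) (k : ℝ) (x w : H) : ℝ :=
  (1 / 2) * ⟪x, E x⟫_ℝ + (1 / 2) * k * ⟪w, F w⟫_ℝ + ⟪x, E (F w)⟫_ℝ

namespace IsNetworkTriple

variable {E K F : H →ₗ[ℝ] H} {lo hi lam : ℝ}

lemma symmF (N : IsNetworkTriple E K F lo hi lam) (x y : H) : ⟪F x, y⟫_ℝ = ⟪x, F y⟫_ℝ := by
  conv_lhs => rw [← N.right_inv y]
  rw [← N.symmK, N.right_inv]

lemma commF (N : IsNetworkTriple E K F lo hi lam) (x : H) : E (F x) = F (E x) := by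
  rw [← N.left_inv (E (F x)), ← N.comm, N.right_inv]

lemma inner_E (N : IsNetworkTriple E K F lo hi lam) (x y : H) : ⟪x, E y⟫_ℝ = ⟪E x, E y⟫_ℝ := by
  rw [N.symmE, N.idemE]

lemma norm_E_le (N : IsNetworkTriple E K F lo hi lam) (x : H) : ‖E x‖ ≤ ‖x‖ := by
  have h : ‖E x‖ * ‖E x‖ ≤ ‖x‖ * ‖E x‖ := by
    rw [← real_inner_self_eq_norm_mul_norm, ← N.inner_E]
    exact real_inner_le_norm _ _
  rcases (norm_nonneg (E x)).eq_or_lt with h0 | h0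
  · rw [← h0]; exact norm_nonneg x
  · exact le_of_mul_le_mul_right h h0

lemma inner_E_le (N : IsNetworkTriple E K F lo hi lam) (x y : H) :
    |⟪x, E y⟫_ℝ| ≤ ‖E x‖ * ‖y‖ := by
  rw [← N.symmE]
  exact abs_real_inner_le_norm _ _

lemma inner_E_self (N : IsNetworkTriple E K F lo hi lam) (x : H) : ⟪x, E x⟫_ℝ = ‖E x‖ ^ 2 := by
  rw [N.inner_E, real_inner_self_eq_norm_sq]

lemma inner_KE (N : IsNetworkTriple E K F lo hi lam) (x y : H) :
    ⟪x, K (E y)⟫_ℝ = ⟪E x, K (E y)⟫_ℝ := by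
  rw [N.symmE, N.comm, N.idemE]

/-- Cauchy–Schwarz for the quadratic form of `K`, in Young's form. -/
lemma two_mul_inner_K_le (N : IsNetworkTriple E K F lo hi lam) (hlo : 0 ≤ lo) (x y : H) :
    2 * ⟪x, K y⟫_ℝ ≤ ⟪x, K x⟫_ℝ + ⟪y, K y⟫_ℝ := by
  have h := (mul_nonneg hlo (sq_nonneg ‖x - y‖)).trans (N.lower (x - y))
  simp only [map_sub, inner_sub_left, inner_sub_right] at h
  have h2 : ⟪y, K x⟫_ℝ = ⟪x, K y⟫_ℝ := by rw [← N.symmK, real_inner_comm]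
  linarith

/-- Young's inequality for the form of `K`, tested on `(1/hi) • K x` and `x`; this needs no square
root of `K`. -/
lemma norm_K_sq_le (N : IsNetworkTriple E K F lo hi lam) (hlo : 0 ≤ lo) (hhi : 0 < hi) (x : H) :
    ‖K x‖ ^ 2 ≤ hi * ⟪x, K x⟫_ℝ := by
  have h := N.two_mul_inner_K_le hlo ((1 / hi) • K x) x
  have h1 := N.upper (K x)
  simp only [map_smul, real_inner_smul_left, real_inner_smul_right,
    real_inner_self_eq_norm_sq] at h
  have h3 : (1 / hi) * ((1 / hi) * ⟪K x, K (K x)⟫_ℝ) ≤ (1 / hi) * ‖K x‖ ^ 2 := by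
    apply mul_le_mul_of_nonneg_left _ (by positivity)
    rw [one_div, inv_mul_le_iff₀ hhi]
    exact h1
  have h2 : (1 / hi) * ‖K x‖ ^ 2 ≤ ⟪x, K x⟫_ℝ := by linarith
  rwa [one_div, inv_mul_le_iff₀ hhi] at h2

lemma norm_K_le (N : IsNetworkTriple E K F lo hi lam) (hlo : 0 ≤ lo) (hhi : 0 < hi) (x : H) :
    ‖K x‖ ^ 2 ≤ hi ^ 2 * ‖x‖ ^ 2 := by
  have h := N.norm_K_sq_le hlo hhi x
  have h1 := mul_le_mul_of_nonneg_left (N.upper x) hhi.le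
  linarith

lemma norm_sq_le_inner_F (N : IsNetworkTriple E K F lo hi lam) (hlo : 0 ≤ lo) (hhi : 0 < hi)
    (w : H) : ‖w‖ ^ 2 ≤ hi * ⟪w, F w⟫_ℝ := by
  have h := N.norm_K_sq_le hlo hhi (F w)
  rwa [N.right_inv, real_inner_comm] at h

lemma norm_F_sq_le (N : IsNetworkTriple E K F lo hi lam) (hlo : 0 < lo) (w : H) :
    ‖F w‖ ^ 2 ≤ lo⁻¹ * ⟪w, F w⟫_ℝ := by
  have h := N.lower (F w)
  rw [N.right_inv, real_inner_comm] at h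
  rwa [le_inv_mul_iff₀ hlo]

lemma inner_F_nonneg (N : IsNetworkTriple E K F lo hi lam) (hlo : 0 < lo) (w : H) :
    0 ≤ ⟪w, F w⟫_ℝ := by
  have h := (sq_nonneg _).trans (N.norm_F_sq_le hlo w)
  exact nonneg_of_mul_nonneg_right h (inv_pos.2 hlo)

lemma norm_F_le (N : IsNetworkTriple E K F lo hi lam) (hlo : 0 < lo) (w : H) :
    ‖F w‖ ≤ lo⁻¹ * ‖w‖ := by
  have h := N.norm_F_sq_le hlo w
  have h1 : ⟪w, F w⟫_ℝ ≤ ‖w‖ * ‖F w‖ := real_inner_le_norm _ _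
  have h2 : ‖F w‖ * ‖F w‖ ≤ (lo⁻¹ * ‖w‖) * ‖F w‖ := by
    have := mul_le_mul_of_nonneg_left h1 (inv_pos.2 hlo).le
    nlinarith
  rcases (norm_nonneg (F w)).eq_or_lt with h0 | h0
  · rw [← h0]; positivity
  · exact le_of_mul_le_mul_right h2 h0

lemma inner_F_le (N : IsNetworkTriple E K F lo hi lam) (hlo : 0 < lo) (w : H) :
    ⟪w, F w⟫_ℝ ≤ lo⁻¹ * ‖w‖ ^ 2 := by
  have h1 : ⟪w, F w⟫_ℝ ≤ ‖w‖ * ‖F w‖ := real_inner_le_norm _ _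
  have h2 := mul_le_mul_of_nonneg_left (N.norm_F_le hlo w) (norm_nonneg w)
  nlinarith

/-- On the kernel of `E` the operator `K` is multiplication by `lam`, hence `F` is multiplication by
`lam⁻¹`; the form splits orthogonally. It recovers the full dual term from `⟪w, E (F w)⟫`, the only
part that is dissipated. -/
lemma inner_F_eq (N : IsNetworkTriple E K F lo hi lam) (hlam : 0 < lam) (w : H) :
    ⟪w, F w⟫_ℝ = ⟪w, E (F w)⟫_ℝ + lam⁻¹ * ‖w - E w‖ ^ 2 := by
  have h : F (w - E w) = lam⁻¹ • (w - E w) := by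
    rw [← N.left_inv (lam⁻¹ • (w - E w)), map_smul, N.consensus, smul_smul,
      inv_mul_cancel₀ hlam.ne', one_smul]
  have h1 : F w = E (F w) + lam⁻¹ • (w - E w) := by
    rw [← h, map_sub, N.commF]; abel
  have h2 : ⟪w, w - E w⟫_ℝ = ‖w - E w‖ ^ 2 := by
    rw [← real_inner_self_eq_norm_sq, inner_sub_left w, inner_sub_right (E w), N.symmE, N.symmE,
      N.idemE, sub_self, sub_zero]
  conv_lhs => rw [h1]
  rw [inner_add_right, real_inner_smul_right, h2]

/-- The energy is bounded below by the consensus error and the dual term. -/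
lemma le_energy (N : IsNetworkTriple E K F lo hi lam) (hlo : 0 < lo) {t : ℝ} (ht : 1 < t * lo)
    (x w : H) :
    (t * lo - 1) / (2 * t * lo) * (‖E x‖ ^ 2 + ⟪w, F w⟫_ℝ) ≤ energy E F (t + 1) x w := by
  have ht0 : 0 < t := by
    by_contra hneg
    nlinarith
  -- The Young weight spends exactly `t/2` of the dual weight `(t+1)/2`. What remains is `1/2` for
  -- the dual term and `1/2 - 1/(2 t lo)` for `‖E x‖²`, the latter being the smaller.
  have h1 : -⟪x, E (F w)⟫_ℝ ≤ 1 / (2 * t * lo) * ‖E x‖ ^ 2 + t / 2 * ⟪w, F w⟫_ℝ := by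
    have hA := (neg_le_abs _).trans (N.inner_E_le x (F w))
    have hB := N.norm_F_sq_le hlo w
    have hC : ‖F w‖ ^ 2 * lo ≤ ⟪w, F w⟫_ℝ := by
      rw [le_inv_mul_iff₀ hlo] at hB
      linarith
    have hD : ‖E x‖ * ‖F w‖ ≤ 1 / (2 * t * lo) * ‖E x‖ ^ 2 + t / 2 * (‖F w‖ ^ 2 * lo) := by
      have h := sq_nonneg (‖E x‖ - t * lo * ‖F w‖)
      have : 1 / (2 * t * lo) * ‖E x‖ ^ 2 + t / 2 * (‖F w‖ ^ 2 * lo) - ‖E x‖ * ‖F w‖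
          = (1 / (2 * t * lo)) * (‖E x‖ - t * lo * ‖F w‖) ^ 2 := by
        field_simp
        ring
      have h' : 0 ≤ (1 / (2 * t * lo)) * (‖E x‖ - t * lo * ‖F w‖) ^ 2 := by positivity
      linarith
    have hE := mul_le_mul_of_nonneg_left hC (by positivity : 0 ≤ t / 2)
    linarith
  have h2 : (t * lo - 1) / (2 * t * lo) = 1 / 2 - 1 / (2 * t * lo) := by
    field_simp
  have h3 : 0 ≤ 1 / (2 * t * lo) * ⟪w, F w⟫_ℝ :=
    mul_nonneg (by positivity) (N.inner_F_nonneg hlo w)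
  rw [h2, energy, N.inner_E_self]
  nlinarith

/-- Expansion of the energy after one iteration. -/
lemma energy_step_eq (N : IsNetworkTriple E K F lo hi lam) {g : ℝ} (hg : g ≠ 0) (t a : ℝ)
    (x u w h D : H) :
    energy E F (t + 1) (x - a • ((t * g) • K (E u) + g • w + h))
        (w + (a * g) • K (E u) + g⁻¹ • D)
      = energy E F (t + 1) x w
        + a * (-(t * g) * ⟪x, K (E u)⟫_ℝ - ⟪x, E h⟫_ℝ + g * ⟪x, E u⟫_ℝ
          + g * (⟪u, E w⟫_ℝ - ⟪x, E w⟫_ℝ) - g * ⟪w, E (F w)⟫_ℝ - ⟪h, E (F w)⟫_ℝ)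
        + ((t + 1) / g * ⟪w, F D⟫_ℝ + g⁻¹ * ⟪x, E (F D)⟫_ℝ)
        + a ^ 2 * ((1 / 2) * (t * g) ^ 2 * ‖K (E u)‖ ^ 2
          + (1 / 2) * g * (g - t * g) * ⟪u, K (E u)⟫_ℝ + (1 / 2) * ‖E (g • w + h)‖ ^ 2
          + ⟪(t * g) • K (E u) - g • E u, g • w + h⟫_ℝ)
        + a * (⟪u, E D⟫_ℝ - ⟪w, E (F D)⟫_ℝ - g⁻¹ * ⟪h, E (F D)⟫_ℝ)
        + (t + 1) / (2 * g ^ 2) * ⟪D, F D⟫_ℝ := by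
  -- `F` undoes `K` in the increments. The pairing of `w` with `E u` receives `(t+1) g` from the
  -- dual term and `-t g` from the cross term; the net `g` matches the `-g ⟪x, E w⟫` of the primal
  -- term, so only `x - u` survives.
  have hFp : F (K (E u)) = E u := N.left_inv _
  have hEp : E (K (E u)) = K (E u) := by rw [N.comm, N.idemE]
  have sE : ∀ y z, ⟪y, E z⟫_ℝ = ⟪z, E y⟫_ℝ := fun y z => by rw [← N.symmE, real_inner_comm]
  have sF : ∀ y z, ⟪y, F z⟫_ℝ = ⟪z, F y⟫_ℝ := fun y z => by rw [← N.symmF, real_inner_comm]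
  have pE : ∀ y, ⟪K (E u), E y⟫_ℝ = ⟪y, K (E u)⟫_ℝ := fun y => by rw [sE, hEp]
  have pF : ∀ y, ⟪K (E u), F y⟫_ℝ = ⟪u, E y⟫_ℝ := fun y => by rw [sF, hFp, sE]
  have pFK : ∀ y, ⟪F y, K (E u)⟫_ℝ = ⟪u, E y⟫_ℝ := fun y => by rw [real_inner_comm, pF]
  have hp : ⟪K (E u), K (E u)⟫_ℝ = ‖K (E u)‖ ^ 2 := real_inner_self_eq_norm_sq _
  rw [← N.inner_E_self (g • w + h)]
  simp only [energy, map_add, map_sub, map_smul, inner_add_left, inner_add_right, inner_sub_left,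
    inner_sub_right, real_inner_smul_left, real_inner_smul_right, hFp, hEp, N.idemE, pE, pF, pFK,
    hp, N.symmE]
  rw [sE w x, sE h x, sE h w, sE w u, sE h u, sE D u, sF D w, real_inner_comm w (K (E u)),
    real_inner_comm h (K (E u))]
  field_simp
  ring

lemma young {s t k : ℝ} (hk : 0 < k) : s * t ≤ k * s ^ 2 + 1 / (4 * k) * t ^ 2 := by
  have h : k * s ^ 2 + 1 / (4 * k) * t ^ 2 - s * t = k * (s - 1 / (2 * k) * t) ^ 2 := by
    field_simp
    ring
  have h1 : 0 ≤ k * (s - 1 / (2 * k) * t) ^ 2 := by positivity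
  linarith

lemma abs_inner_EF_le (N : IsNetworkTriple E K F lo hi lam) (hlo : 0 < lo) (x y : H) :
    |⟪x, E (F y)⟫_ℝ| ≤ ‖E x‖ * (lo⁻¹ * ‖y‖) :=
  (N.inner_E_le x (F y)).trans (mul_le_mul_of_nonneg_left (N.norm_F_le hlo y) (norm_nonneg _))

/-- Dissipation comes from `-b ⟪x, K (E x)⟫` and `-g ⟪w, E (F w)⟫`; all else is absorbed by Young's
inequality. Replacing the latter by the full dual term costs `g / lam ≤ g² / 5` times the consensus
part of `w`, which is later paid for by the gradient term of the descent lemma. -/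
lemma first_order_le (N : IsNetworkTriple E K F lo hi lam) (hlo : 0 < lo) (hhi : 0 < hi)
    (hlam : lo ≤ lam) {l b g : ℝ} (hb : 0 ≤ b) (hg : 0 < g) (hglo : 5 ≤ g * lo)
    (x e w h : H) (hh : ‖h‖ ≤ l * ‖E x‖) :
    -b * ⟪x, K (E (x - e))⟫_ℝ - ⟪x, E h⟫_ℝ + g * ⟪x, E (x - e)⟫_ℝ
          + g * (⟪x - e, E w⟫_ℝ - ⟪x, E w⟫_ℝ) - g * ⟪w, E (F w)⟫_ℝ - ⟪h, E (F w)⟫_ℝ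
      ≤ -((1 / 2) * b * lo - (3 / 2) * g - 1 - (7 / 20) * l ^ 2) * ‖E x‖ ^ 2
        - ((3 / 4) * g - (5 / 2) * lo⁻¹) * ⟪w, F w⟫_ℝ + g ^ 2 / 5 * ‖w - E w‖ ^ 2
        + ((hi + 1) * g + (1 / 2) * hi * b) * ‖e‖ ^ 2 := by
  set X := ‖E x‖ with hX
  have hXn : 0 ≤ X := norm_nonneg _
  have hEe := N.norm_E_le e
  have hEe2 : ‖E e‖ ^ 2 ≤ ‖e‖ ^ 2 := pow_le_pow_left₀ (norm_nonneg _) hEe 2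
  have hlam0 : 0 < lam := hlo.trans_le hlam
  have i1 : -⟪x, K (E (x - e))⟫_ℝ ≤ -(1 / 2) * lo * X ^ 2 + (1 / 2) * hi * ‖e‖ ^ 2 := by
    have h1 := N.two_mul_inner_K_le hlo.le (E x) (E e)
    have h2 := N.lower (E x)
    have h3 := N.upper (E e)
    have h4 := mul_le_mul_of_nonneg_left hEe2 hhi.le
    rw [map_sub, map_sub, inner_sub_right, N.inner_KE, N.inner_KE x e]
    linarith
  have i2 : -⟪x, E h⟫_ℝ ≤ (1 + l ^ 2 / 4) * X ^ 2 := by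
    have h1 := (neg_le_abs _).trans (N.inner_E_le x h)
    have h2 := mul_le_mul_of_nonneg_left hh hXn
    nlinarith [sq_nonneg ((l / 2 - 1) * X)]
  have i3 : ⟪x, E (x - e)⟫_ℝ ≤ (3 / 2) * X ^ 2 + (1 / 2) * ‖e‖ ^ 2 := by
    have h1 := (neg_le_abs _).trans (N.inner_E_le x e)
    rw [map_sub, inner_sub_right, N.inner_E_self]
    nlinarith [sq_nonneg (X - ‖e‖)]
  have i4 : ⟪x - e, E w⟫_ℝ - ⟪x, E w⟫_ℝ ≤ hi * ‖e‖ ^ 2 + (1 / 4) * ⟪w, F w⟫_ℝ := by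
    have h1 := (neg_le_abs _).trans (N.inner_E_le e w)
    have h2 := mul_le_mul_of_nonneg_right hEe (norm_nonneg w)
    have h3 : ‖e‖ * ‖w‖ ≤ _ := young hhi
    have h4 := N.norm_sq_le_inner_F hlo.le hhi w
    have h5 : 1 / (4 * hi) * ‖w‖ ^ 2 ≤ (1 / 4) * ⟪w, F w⟫_ℝ := by
      rw [div_mul_eq_mul_div, div_le_iff₀ (by positivity)]
      linarith
    rw [inner_sub_left]
    linarith
  have i5 : -g * ⟪w, E (F w)⟫_ℝ ≤ -g * ⟪w, F w⟫_ℝ + g ^ 2 / 5 * ‖w - E w‖ ^ 2 := by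
    have h1 := N.inner_F_eq hlam0 w
    have h2 : g * lam⁻¹ ≤ g ^ 2 / 5 := by
      rw [← div_eq_mul_inv, div_le_div_iff₀ hlam0 (by norm_num)]
      have := mul_le_mul_of_nonneg_left hlam hg.le
      nlinarith
    have h3 := mul_le_mul_of_nonneg_right h2 (sq_nonneg ‖w - E w‖)
    rw [h1]
    linarith
  have i6 : -⟪h, E (F w)⟫_ℝ ≤ (5 / 2) * lo⁻¹ * ⟪w, F w⟫_ℝ + l ^ 2 / 10 * X ^ 2 := by
    have h1 := (neg_le_abs _).trans (N.inner_E_le h (F w))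
    have h2 := mul_le_mul_of_nonneg_right ((N.norm_E_le h).trans hh) (norm_nonneg (F w))
    have h3 := N.norm_F_sq_le hlo w
    nlinarith [sq_nonneg (l * X - 5 * ‖F w‖)]
  nlinarith [mul_le_mul_of_nonneg_left i1 hb, mul_le_mul_of_nonneg_left i3 hg.le,
    mul_le_mul_of_nonneg_left i4 hg.le, mul_nonneg hg.le (sq_nonneg ‖e‖)]

/-- `D` is the change of the local gradients at the average, of size `a G`, so these terms are of
first order in `a`. They use a further `g/4` of the dual dissipation; the part in `G²` is left to
the descent lemma. -/
lemma drift_le (N : IsNetworkTriple E K F lo hi lam) (hlo : 0 < lo)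
    {l g k a G : ℝ} (hl : 0 < l) (hg : 0 < g) (hglo : 5 ≤ g * lo) (hk : 0 ≤ k) (ha : 0 ≤ a)
    (hG : 0 ≤ G) (x w D : H) (hD : ‖D‖ ≤ l * (a * G)) :
    k / g * ⟪w, F D⟫_ℝ + g⁻¹ * ⟪x, E (F D)⟫_ℝ
      ≤ a * (g / 4 * ⟪w, F w⟫_ℝ + l ^ 2 / 10 * ‖E x‖ ^ 2
        + (k ^ 2 / g ^ 3 * lo⁻¹ * l ^ 2 + 1 / 10) * G ^ 2) := by
  have hFw := N.norm_F_sq_le hlo w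
  have j1 : k / g * ⟪w, F D⟫_ℝ
      ≤ a * (g / 4 * ⟪w, F w⟫_ℝ + k ^ 2 / g ^ 3 * lo⁻¹ * l ^ 2 * G ^ 2) := by
    have h1 : ⟪w, F D⟫_ℝ ≤ ‖F w‖ * (l * (a * G)) := by
      rw [← N.symmF]
      exact (real_inner_le_norm _ _).trans (mul_le_mul_of_nonneg_left hD (norm_nonneg _))
    have h2 := mul_le_mul_of_nonneg_left h1 (by positivity : 0 ≤ k / g)
    -- The weight `g lo / 4` turns into `g/4` under `lo ‖F w‖² ≤ ⟪w, F w⟫`.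
    have h3 : ‖F w‖ * (k / g * l * G) ≤ _ := young (by positivity : 0 < g * lo / 4)
    have h4 : g * lo / 4 * ‖F w‖ ^ 2 ≤ g / 4 * ⟪w, F w⟫_ℝ := by
      rw [le_inv_mul_iff₀ hlo] at hFw
      nlinarith
    have h5 : 1 / (4 * (g * lo / 4)) * (k / g * l * G) ^ 2
        = k ^ 2 / g ^ 3 * lo⁻¹ * l ^ 2 * G ^ 2 := by
      field_simp
    rw [h5] at h3
    nlinarith [mul_le_mul_of_nonneg_left (h3.trans (by gcongr)) ha]
  have j2 : g⁻¹ * ⟪x, E (F D)⟫_ℝ ≤ a * (l ^ 2 / 10 * ‖E x‖ ^ 2 + 1 / 10 * G ^ 2) := by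
    have h1 := (le_abs_self _).trans (N.abs_inner_EF_le hlo x D)
    have h2 : ‖E x‖ * (lo⁻¹ * ‖D‖) ≤ ‖E x‖ * (lo⁻¹ * (l * (a * G))) := by gcongr
    have h3 := mul_le_mul_of_nonneg_left (h1.trans h2) (by positivity : 0 ≤ g⁻¹)
    have h4 : g⁻¹ * lo⁻¹ ≤ 1 / 5 := by
      rw [← mul_inv, one_div]
      exact inv_anti₀ (by norm_num) hglo
    have h5 := mul_le_mul_of_nonneg_right h4 (by positivity : 0 ≤ a * (l * ‖E x‖ * G))
    have h6 := mul_nonneg ha (sq_nonneg (l * ‖E x‖ - G))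
    linarith
  linarith

/-- Completing the inner product to squares leaves the products `b g ⟪u, K (E u)⟫` with a negative
sign, so they can be dropped; the rest is bounded by the spectral bounds of `K`. -/
lemma second_order_le (N : IsNetworkTriple E K F lo hi lam) (hlo : 0 < lo) (hhi : 0 < hi)
    {l b g : ℝ} (hb : 0 ≤ b) (hg : 0 < g) (x e w h : H)
    (hh : ‖h‖ ≤ l * ‖E x‖) :
    (1 / 2) * b ^ 2 * ‖K (E (x - e))‖ ^ 2
          + (1 / 2) * g * (g - b) * ⟪x - e, K (E (x - e))⟫_ℝ + (1 / 2) * ‖E (g • w + h)‖ ^ 2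
          + ⟪b • K (E (x - e)) - g • E (x - e), g • w + h⟫_ℝ
      ≤ (2 * hi ^ 2 * b ^ 2 + (hi + 1) * g ^ 2) * (‖E x‖ ^ 2 + ‖e‖ ^ 2)
        + 2 * l ^ 2 * ‖E x‖ ^ 2 + 2 * hi * g ^ 2 * ⟪w, F w⟫_ℝ := by
  set u := x - e with hu
  have hU : ‖E u‖ ^ 2 ≤ 2 * (‖E x‖ ^ 2 + ‖e‖ ^ 2) := by
    have h1 : ‖E u‖ ≤ ‖E x‖ + ‖e‖ := by
      rw [hu, map_sub]
      exact (norm_sub_le _ _).trans (by gcongr; exact N.norm_E_le e)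
    have h2 := pow_le_pow_left₀ (norm_nonneg _) h1 2
    nlinarith [sq_nonneg (‖E x‖ - ‖e‖)]
  have hEp : E (K (E u)) = K (E u) := by rw [N.comm, N.idemE]
  have hS : ‖E (g • w + h)‖ ^ 2 ≤ 2 * hi * g ^ 2 * ⟪w, F w⟫_ℝ + 2 * l ^ 2 * ‖E x‖ ^ 2 := by
    have h1 : ‖E (g • w + h)‖ ≤ g * ‖w‖ + l * ‖E x‖ := by
      refine (N.norm_E_le _).trans ((norm_add_le _ _).trans ?_)
      rw [norm_smul, Real.norm_of_nonneg hg.le]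
      gcongr
    have h2 := pow_le_pow_left₀ (norm_nonneg _) h1 2
    have h3 := mul_le_mul_of_nonneg_left (N.norm_sq_le_inner_F hlo.le hhi w) (sq_nonneg g)
    nlinarith [sq_nonneg (g * ‖w‖ - l * ‖E x‖)]
  have hI : ⟪b • K (E u) - g • E u, g • w + h⟫_ℝ
      ≤ (1 / 2) * (b ^ 2 * ‖K (E u)‖ ^ 2 - 2 * b * g * ⟪u, K (E u)⟫_ℝ + g ^ 2 * ‖E u‖ ^ 2)
        + (1 / 2) * ‖E (g • w + h)‖ ^ 2 := by
    have h1 : b • K (E u) - g • E u = E (b • K (E u) - g • E u) := by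
      simp only [map_sub, map_smul, hEp, N.idemE]
    have h2 : ‖b • K (E u) - g • E u‖ ^ 2
        = b ^ 2 * ‖K (E u)‖ ^ 2 - 2 * b * g * ⟪u, K (E u)⟫_ℝ + g ^ 2 * ‖E u‖ ^ 2 := by
      rw [norm_sub_sq_real, norm_smul, norm_smul, mul_pow, mul_pow, Real.norm_eq_abs,
        Real.norm_eq_abs, sq_abs, sq_abs, real_inner_smul_left, real_inner_smul_right,
        N.inner_KE, real_inner_comm (E u)]
      ring
    rw [← h2, h1, N.symmE, N.inner_E, ← h1]
    have h3 := real_inner_le_norm (b • K (E u) - g • E u) (E (g • w + h))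
    nlinarith [sq_nonneg (‖b • K (E u) - g • E u‖ - ‖E (g • w + h)‖)]
  have hK := N.norm_K_le hlo.le hhi (E u)
  have hL := N.upper (E u)
  have hL0 := (mul_nonneg hlo.le (sq_nonneg ‖E u‖)).trans (N.lower (E u))
  rw [N.inner_KE u u] at *
  have k1 := mul_le_mul_of_nonneg_left hK (sq_nonneg b)
  have k2 := mul_le_mul_of_nonneg_left hL (sq_nonneg g)
  have k3 := mul_nonneg (mul_nonneg hb hg.le) hL0
  have k4 := mul_le_mul_of_nonneg_left hU
    (by positivity : 0 ≤ b ^ 2 * hi ^ 2 + (1 / 2) * g ^ 2 * hi + (1 / 2) * g ^ 2)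
  linarith

lemma drift_sq_le (N : IsNetworkTriple E K F lo hi lam) (hlo : 0 < lo) (hhi : 0 < hi)
    {l g k a G : ℝ} (hl : 0 < l) (hg : 0 < g) (hk : 0 ≤ k) (ha : 0 ≤ a)
    (x e w h D : H) (hh : ‖h‖ ≤ l * ‖E x‖) (hD : ‖D‖ ≤ l * (a * G)) :
    a * (⟪x - e, E D⟫_ℝ - ⟪w, E (F D)⟫_ℝ - g⁻¹ * ⟪h, E (F D)⟫_ℝ)
        + k / (2 * g ^ 2) * ⟪D, F D⟫_ℝ
      ≤ a ^ 2 * (‖E x‖ ^ 2 + ‖e‖ ^ 2 + (1 / 2) * hi * ⟪w, F w⟫_ℝ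
        + (1 / 2) * l ^ 2 * ‖E x‖ ^ 2
        + (k / (2 * g ^ 2) * lo⁻¹ * l ^ 2 + 1 / (2 * g ^ 2) * lo⁻¹ ^ 2 * l ^ 2
          + lo⁻¹ ^ 2 / 2 * l ^ 2 + l ^ 2 / 2) * G ^ 2) := by
  have m1 : ⟪x - e, E D⟫_ℝ ≤ a * (‖E x‖ ^ 2 + ‖e‖ ^ 2 + l ^ 2 / 2 * G ^ 2) := by
    have h1 : ‖E (x - e)‖ ≤ ‖E x‖ + ‖e‖ := by
      rw [map_sub]
      exact (norm_sub_le _ _).trans (by gcongr; exact N.norm_E_le e)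
    have h2 : ⟪x - e, E D⟫_ℝ ≤ (‖E x‖ + ‖e‖) * (l * (a * G)) :=
      (le_abs_self _).trans ((N.inner_E_le _ D).trans (by gcongr))
    have h3 := mul_nonneg ha (sq_nonneg (‖E x‖ + ‖e‖ - l * G))
    have h4 := mul_nonneg ha (sq_nonneg (‖E x‖ - ‖e‖))
    linarith
  have m2 : -⟪w, E (F D)⟫_ℝ ≤ a * ((1 / 2) * hi * ⟪w, F w⟫_ℝ + lo⁻¹ ^ 2 / 2 * l ^ 2 * G ^ 2) := by
    have h1 := (neg_le_abs _).trans (N.abs_inner_EF_le hlo w D)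
    have h2 : ‖E w‖ * (lo⁻¹ * ‖D‖) ≤ ‖w‖ * (lo⁻¹ * (l * (a * G))) := by
      gcongr
      exact N.norm_E_le w
    have h3 := mul_nonneg ha (sq_nonneg (‖w‖ - lo⁻¹ * l * G))
    have h4 := mul_le_mul_of_nonneg_left (N.norm_sq_le_inner_F hlo.le hhi w) ha
    linarith
  have m3 : -(g⁻¹ * ⟪h, E (F D)⟫_ℝ)
      ≤ a * ((1 / 2) * l ^ 2 * ‖E x‖ ^ 2 + 1 / (2 * g ^ 2) * lo⁻¹ ^ 2 * l ^ 2 * G ^ 2) := by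
    have h1 := (neg_le_abs _).trans (N.abs_inner_EF_le hlo h D)
    have h2 : ‖E h‖ * (lo⁻¹ * ‖D‖) ≤ (l * ‖E x‖) * (lo⁻¹ * (l * (a * G))) := by
      gcongr
      exact (N.norm_E_le h).trans hh
    have h3 := mul_nonneg ha (sq_nonneg (l * ‖E x‖ - g⁻¹ * lo⁻¹ * l * G))
    have h4 := mul_le_mul_of_nonneg_left (h1.trans h2) (by positivity : 0 ≤ g⁻¹)
    have h5 : 1 / (2 * g ^ 2) = (1 / 2) * g⁻¹ ^ 2 := by field_simp
    rw [h5]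
    linarith
  have m4 : k / (2 * g ^ 2) * ⟪D, F D⟫_ℝ
      ≤ a ^ 2 * (k / (2 * g ^ 2) * lo⁻¹ * l ^ 2 * G ^ 2) := by
    have h1 := N.inner_F_le hlo D
    have h2 := pow_le_pow_left₀ (norm_nonneg _) hD 2
    have h3 := mul_le_mul_of_nonneg_left h2 (inv_pos.2 hlo).le
    have h4 := mul_le_mul_of_nonneg_left (h1.trans h3) (by positivity : 0 ≤ k / (2 * g ^ 2))
    linarith
  have := mul_le_mul_of_nonneg_left (add_le_add (add_le_add m1 m2) m3) ha
  linarith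

/-- Change of the energy in one iteration. -/
lemma energy_step_le {c : Params} (N : IsNetworkTriple E K F c.rho2 c.rho lam)
    (hrho2 : 0 < c.rho2) (hlam : c.rho2 ≤ lam) (hlam' : lam ≤ c.rho) (hell : 0 < c.ell)
    (htau1 : 0 ≤ c.tau1) (hgam : 0 < c.gam) (hgr : 5 ≤ c.gam * c.rho2) {a G : ℝ} (ha : 0 ≤ a)
    (hG : 0 ≤ G) (x e w h D : H) (hh : ‖h‖ ≤ c.ell * ‖E x‖) (hD : ‖D‖ ≤ c.ell * (a * G)) :
    energy E F (c.tau1 + 1) (x - a • (c.beta • K (E (x - e)) + c.gam • w + h))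
        (w + (a * c.gam) • K (E (x - e)) + c.gam⁻¹ • D)
      ≤ energy E F (c.tau1 + 1) x w
        - a * (c.phi1 + (11 / 20) * c.ell ^ 2 - a * c.phi2) * ‖E x‖ ^ 2
        - a * (c.phi3 - a * c.phi4) * ⟪w, F w⟫_ℝ
        + a * (9 / 40 - c.phi5 + a * (c.phi6 - c.ell / 2)) * G ^ 2
        + a * (c.gam ^ 2 / 5) * ‖w - E w‖ ^ 2 + a * c.psi2 a * ‖e‖ ^ 2 := by
  have hrho : 0 < c.rho := hrho2.trans_le (hlam.trans hlam')
  have hb : 0 ≤ c.tau1 * c.gam := by positivity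
  have i1 := mul_le_mul_of_nonneg_left
    (N.first_order_le hrho2 hrho hlam hb hgam hgr x e w h hh) ha
  have i2 := N.drift_le hrho2 hell hgam hgr (by positivity : 0 ≤ c.tau1 + 1) ha hG x w D hD
  have i3 := mul_le_mul_of_nonneg_left
    (N.second_order_le hrho2 hrho hb hgam x e w h hh) (sq_nonneg a)
  have i4 := N.drift_sq_le hrho2 hrho hell hgam (by positivity : 0 ≤ c.tau1 + 1) ha x e w h D
    hh hD
  have hbr : c.rho2 * (c.tau1 * c.gam) * c.gam ≤ c.rho * (c.tau1 * c.gam) * c.gam := by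
    have := hlam.trans hlam'
    gcongr
  have r1 : 0 ≤ c.rho ^ 2 * (c.tau1 * c.gam) ^ 2 - c.rho2 * (c.tau1 * c.gam) * c.gam
      + c.gam ^ 2 := by
    linarith [sq_nonneg (c.rho * (c.tau1 * c.gam) - c.gam / 2), sq_nonneg c.gam]
  have r2 : 0 ≤ c.rho ^ 2 * (c.tau1 * c.gam) ^ 2
      + (c.rho - 2 * c.rho2) * (c.tau1 * c.gam) * c.gam + c.gam ^ 2 := by
    linarith [sq_nonneg (c.rho * (c.tau1 * c.gam) - c.gam / 2), sq_nonneg c.gam]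
  have r3 := mul_nonneg (mul_nonneg (sq_nonneg a) r1) (sq_nonneg ‖E x‖)
  have r4 := mul_nonneg (mul_nonneg (sq_nonneg a) r2) (sq_nonneg ‖e‖)
  -- The `1/10` left by the drift and the `1/8` inside `phi5` add up to `9/40`.
  have p5 : (c.tau1 + 1) ^ 2 / c.gam ^ 3 * c.rho2⁻¹ * c.ell ^ 2 + 1 / 10 ≤ 9 / 40 - c.phi5 := by
    have h1 : (c.beta + c.gam) ^ 2 / c.gam ^ 5 = (c.tau1 + 1) ^ 2 / c.gam ^ 3 := by
      rw [Params.beta]; field_simp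
    have h2 : 0 ≤ 1 / (2 * c.gam ^ 2) * (c.rho2⁻¹) ^ 2 * c.ell ^ 2 := by positivity
    rw [Params.phi5, h1]
    linarith
  have p6 : (c.tau1 + 1) / (2 * c.gam ^ 2) * c.rho2⁻¹ * c.ell ^ 2
      + 1 / (2 * c.gam ^ 2) * c.rho2⁻¹ ^ 2 * c.ell ^ 2
          + c.rho2⁻¹ ^ 2 / 2 * c.ell ^ 2 + c.ell ^ 2 / 2 = c.phi6 - c.ell / 2 := by
    have h1 : (c.beta + c.gam) / (2 * c.gam ^ 3) = (c.tau1 + 1) / (2 * c.gam ^ 2) := by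
      rw [Params.beta]; field_simp
    rw [Params.phi6, h1]
    ring
  have p5' := mul_le_mul_of_nonneg_left p5 (mul_nonneg ha (sq_nonneg G))
  rw [p6] at i4
  rw [Params.beta, N.energy_step_eq hgam.ne']
  simp only [Params.phi1, Params.phi2, Params.phi3, Params.phi4, Params.psi2, Params.phi7,
    Params.phi8, Params.beta]
  linarith

end IsNetworkTriple

end Operators

/-! ### Smooth functions -/

section Smooth

variable {V : Type*} [NormedAddCommGroup V] [InnerProductSpace ℝ V] [CompleteSpace V]

/-- The descent lemma for functions with a Lipschitz gradient. -/
lemma le_add_inner_gradient_add {f : V → ℝ} (hf : Differentiable ℝ f) {l : ℝ}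
    (hlip : ∀ x y, ‖∇ f x - ∇ f y‖ ≤ l * ‖x - y‖) (x v : V) :
    f (x + v) ≤ f x + ⟪∇ f x, v⟫_ℝ + l / 2 * ‖v‖ ^ 2 := by
  -- `f` along the segment minus the non-constant part of its quadratic majorant; the Lipschitz
  -- bound makes it antitone on `[0, 1]`, and comparing endpoints is the claim.
  set F : ℝ → ℝ := fun t => f (x + t • v) - t * ⟪∇ f x, v⟫_ℝ - l / 2 * ‖v‖ ^ 2 * t ^ 2 with hF
  have hd : ∀ t, HasDerivAt F
      (⟪∇ f (x + t • v), v⟫_ℝ - ⟪∇ f x, v⟫_ℝ - l / 2 * ‖v‖ ^ 2 * (2 * t)) t := by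
    intro t
    have h1 : HasDerivAt (fun t : ℝ => x + t • v) v t := by
      simpa using ((hasDerivAt_id t).smul_const v).const_add x
    have h2 : HasDerivAt (fun t : ℝ => f (x + t • v)) (⟪∇ f (x + t • v), v⟫_ℝ) t := by
      have := (hf (x + t • v)).hasFDerivAt.comp_hasDerivAt t h1
      rwa [← inner_gradient_left] at this
    have h3 : HasDerivAt (fun t : ℝ => t * ⟪∇ f x, v⟫_ℝ) (⟪∇ f x, v⟫_ℝ) t := by
      simpa using (hasDerivAt_id t).mul_const (⟪∇ f x, v⟫_ℝ)
    have h4 : HasDerivAt (fun t : ℝ => l / 2 * ‖v‖ ^ 2 * t ^ 2) (l / 2 * ‖v‖ ^ 2 * (2 * t)) t := by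
      simpa using ((hasDerivAt_id t).pow 2).const_mul (l / 2 * ‖v‖ ^ 2)
    exact (h2.sub h3).sub h4
  have hanti : AntitoneOn F (Set.Icc 0 1) := by
    refine antitoneOn_of_deriv_nonpos (convex_Icc 0 1)
      (fun t _ => (hd t).continuousAt.continuousWithinAt)
      (fun t _ => (hd t).differentiableAt.differentiableWithinAt) ?_
    intro t ht
    rw [interior_Icc] at ht
    rw [(hd t).deriv, ← inner_sub_left]
    have h1 := real_inner_le_norm (∇ f (x + t • v) - ∇ f x) v
    have h2 := hlip (x + t • v) x
    rw [add_sub_cancel_left, norm_smul, Real.norm_of_nonneg ht.1.le] at h2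
    have h3 := mul_le_mul_of_nonneg_right h2 (norm_nonneg v)
    linarith
  have h := hanti (Set.left_mem_Icc.2 zero_le_one) (Set.right_mem_Icc.2 zero_le_one) zero_le_one
  simp only [hF, one_smul, zero_smul, add_zero] at h
  linarith

end Smooth

lemma hasGradientAt_globalCost {n d : ℕ} {f : Fin n → Vec d → ℝ}
    (hf : ∀ i, Differentiable ℝ (f i)) (x : Vec d) :
    HasGradientAt (globalCost f) ((1 / (n : ℝ)) • ∑ i, ∇ (f i) x) x := by
  rw [hasGradientAt_iff_hasFDerivAt]
  have h1 : HasFDerivAt (fun x => ∑ i, f i x) (∑ i, fderiv ℝ (f i) x) x :=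
    HasFDerivAt.fun_sum fun i _ => (hf i x).hasFDerivAt
  have h2 := h1.const_mul (1 / (n : ℝ))
  refine h2.congr_fderiv ?_
  ext v
  simp

lemma gradient_globalCost {n d : ℕ} {f : Fin n → Vec d → ℝ}
    (hf : ∀ i, Differentiable ℝ (f i)) (x : Vec d) :
    ∇ (globalCost f) x = (1 / (n : ℝ)) • ∑ i, ∇ (f i) x :=
  (hasGradientAt_globalCost hf x).gradient

lemma gradient_globalCost_lipschitz {n d : ℕ} (hn : 0 < n) {f : Fin n → Vec d → ℝ} {l : ℝ}
    (hf : ∀ i, Differentiable ℝ (f i)) (hlip : ∀ i x y, ‖∇ (f i) x - ∇ (f i) y‖ ≤ l * ‖x - y‖)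
    (x y : Vec d) : ‖∇ (globalCost f) x - ∇ (globalCost f) y‖ ≤ l * ‖x - y‖ := by
  have hn' : (0 : ℝ) < n := by exact_mod_cast hn
  rw [gradient_globalCost hf, gradient_globalCost hf, ← smul_sub, ← Finset.sum_sub_distrib,
    norm_smul, Real.norm_of_nonneg (by positivity), one_div, inv_mul_le_iff₀ hn']
  refine (norm_sum_le _ _).trans ((Finset.sum_le_sum fun i _ => hlip i x y).trans ?_)
  simp

/-! ### Comparison of `ℓ_p` norms -/

/-- With `S = ∑ a_i^p`, each `a_i^q = a_i^p (a_i^p)^((q-p)/p)` is at most `a_i^p S^((q-p)/p)`; then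
sum. -/
lemma rpow_sum_rpow_anti {ι : Type*} (s : Finset ι) {a : ι → ℝ} (ha : ∀ i, 0 ≤ a i) {p q : ℝ}
    (hp : 0 < p) (hpq : p ≤ q) :
    (∑ i ∈ s, a i ^ q) ^ (1 / q) ≤ (∑ i ∈ s, a i ^ p) ^ (1 / p) := by
  have hq : 0 < q := hp.trans_le hpq
  set S := ∑ i ∈ s, a i ^ p with hS
  have hS0 : 0 ≤ S := Finset.sum_nonneg fun i _ => Real.rpow_nonneg (ha i) p
  have h1 : ∀ i ∈ s, a i ^ q ≤ a i ^ p * S ^ ((q - p) / p) := by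
    intro i hi
    have h2 : a i ^ p ≤ S :=
      Finset.single_le_sum (f := fun i => a i ^ p) (fun j _ => Real.rpow_nonneg (ha j) p) hi
    have h3 : a i ^ q = a i ^ p * (a i ^ p) ^ ((q - p) / p) := by
      rw [← Real.rpow_mul (ha i), mul_div_cancel₀ _ hp.ne', ← Real.rpow_add_of_nonneg (ha i) hp.le
        (sub_nonneg.2 hpq), add_sub_cancel]
    rw [h3]
    exact mul_le_mul_of_nonneg_left (Real.rpow_le_rpow (Real.rpow_nonneg (ha i) p) h2
      (div_nonneg (sub_nonneg.2 hpq) hp.le)) (Real.rpow_nonneg (ha i) p)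
  have h4 : ∑ i ∈ s, a i ^ q ≤ S ^ (q / p) := by
    refine (Finset.sum_le_sum h1).trans ?_
    rw [← Finset.sum_mul, ← hS]
    have h5 : q / p = 1 + (q - p) / p := by field_simp; ring
    rw [h5, Real.rpow_add_of_nonneg hS0 zero_le_one (div_nonneg (sub_nonneg.2 hpq) hp.le),
      Real.rpow_one]
  refine (Real.rpow_le_rpow (Finset.sum_nonneg fun i _ => Real.rpow_nonneg (ha i) q) h4
    (by positivity)).trans ?_
  rw [← Real.rpow_mul hS0]
  apply le_of_eq
  congr 1
  field_simp

/-- The power mean inequality with exponent `q / p ≥ 1`, applied to `a_i^p`. -/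
lemma rpow_sum_rpow_le_card {ι : Type*} (s : Finset ι) {a : ι → ℝ} (ha : ∀ i, 0 ≤ a i) {p q : ℝ}
    (hp : 0 < p) (hpq : p ≤ q) :
    (∑ i ∈ s, a i ^ p) ^ (1 / p)
      ≤ (s.card : ℝ) ^ (1 / p - 1 / q) * (∑ i ∈ s, a i ^ q) ^ (1 / q) := by
  have hq : 0 < q := hp.trans_le hpq
  have hS0 : 0 ≤ ∑ i ∈ s, a i ^ p := Finset.sum_nonneg fun i _ => Real.rpow_nonneg (ha i) p
  have h := Real.rpow_sum_le_const_mul_sum_rpow_of_nonneg s ((one_le_div hp).2 hpq)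
    (f := fun i => a i ^ p) (fun i _ => Real.rpow_nonneg (ha i) p)
  have h1 : ∀ i, (a i ^ p) ^ (q / p) = a i ^ q := fun i => by
    rw [← Real.rpow_mul (ha i), mul_div_cancel₀ _ hp.ne']
  simp only [h1] at h
  have h2 := Real.rpow_le_rpow (Real.rpow_nonneg hS0 _) h (by positivity : 0 ≤ 1 / q)
  rw [Real.mul_rpow (by positivity) (Finset.sum_nonneg fun i _ => Real.rpow_nonneg (ha i) q),
    ← Real.rpow_mul hS0, ← Real.rpow_mul (by positivity)] at h2
  have e1 : q / p * (1 / q) = 1 / p := by field_simp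
  have e2 : (q / p - 1) * (1 / q) = 1 / p - 1 / q := by field_simp
  rwa [e1, e2] at h2

section LpNorm

variable {d : ℕ} {p : ℝ≥0∞}

lemma lpNorm_eq_sum (hp : 1 ≤ p) (hp' : p ≠ ∞) (x : Vec d) :
    lpNorm p x = (∑ i, ‖x i‖ ^ p.toReal) ^ (1 / p.toReal) :=
  PiLp.norm_eq_sum (ENNReal.toReal_pos (zero_lt_one.trans_le hp).ne' hp') _

lemma norm_eq_rpow_sum (x : Vec d) : ‖x‖ = (∑ i, ‖x i‖ ^ (2 : ℝ)) ^ (1 / (2 : ℝ)) := by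
  have := PiLp.norm_eq_sum (p := 2) (by norm_num) x
  simpa using this

lemma lpNorm_le_dHat_mul (hp : 1 ≤ p) (x : Vec d) : lpNorm p x ≤ dHat p d * ‖x‖ := by
  by_cases h2 : p ≤ 2
  · have hp' : p ≠ ∞ := ne_top_of_le_ne_top (by norm_num) h2
    have hpr : p.toReal ≤ 2 := by
      simpa using ENNReal.toReal_mono (by norm_num) h2
    have h := rpow_sum_rpow_le_card Finset.univ (fun i => norm_nonneg (x i))
      (ENNReal.toReal_pos (zero_lt_one.trans_le hp).ne' hp') hpr
    rw [dHat, if_pos h2, lpNorm_eq_sum hp hp', norm_eq_rpow_sum]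
    simpa [ENNReal.toReal_inv] using h
  · rw [dHat, if_neg h2, one_mul]
    by_cases hp' : p = ∞
    · subst hp'
      rw [lpNorm, PiLp.norm_toLp, pi_norm_le_iff_of_nonneg (norm_nonneg _)]
      exact fun i => PiLp.norm_apply_le x i
    · have hpr : 2 ≤ p.toReal := by
        simpa using ENNReal.toReal_mono hp' (not_le.1 h2).le
      rw [lpNorm_eq_sum hp hp', norm_eq_rpow_sum]
      exact rpow_sum_rpow_anti Finset.univ (fun i => norm_nonneg (x i)) (by norm_num) hpr

lemma norm_le_dTilde_mul (hp : 1 ≤ p) (x : Vec d) : ‖x‖ ≤ dTilde p d * lpNorm p x := by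
  by_cases h2 : p ≤ 2
  · have hp' : p ≠ ∞ := ne_top_of_le_ne_top (by norm_num) h2
    have hpr : p.toReal ≤ 2 := by
      simpa using ENNReal.toReal_mono (by norm_num) h2
    rw [dTilde, if_pos h2, one_mul, lpNorm_eq_sum hp hp', norm_eq_rpow_sum]
    exact rpow_sum_rpow_anti Finset.univ (fun i => norm_nonneg (x i))
      (ENNReal.toReal_pos (zero_lt_one.trans_le hp).ne' hp') hpr
  · rw [dTilde, if_neg h2]
    by_cases hp' : p = ∞
    · subst hp'
      have hs : ‖x‖ ^ 2 ≤ d * lpNorm ∞ x ^ 2 := by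
        rw [EuclideanSpace.norm_sq_eq]
        refine (Finset.sum_le_card_nsmul _ _ (lpNorm ∞ x ^ 2) fun i _ => ?_).trans (by simp)
        rw [lpNorm, PiLp.norm_toLp]
        exact pow_le_pow_left₀ (norm_nonneg _) (norm_le_pi_norm (WithLp.ofLp x) i) 2
      have h0 : 0 ≤ lpNorm ∞ x := norm_nonneg _
      refine le_of_sq_le_sq ?_ (by positivity)
      rw [mul_pow, ← Real.rpow_natCast (_ ^ _) 2, ← Real.rpow_mul (by positivity)]
      simpa using hs
    · have hpr : 2 ≤ p.toReal := by
        simpa using ENNReal.toReal_mono hp' (not_le.1 h2).le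
      have h := rpow_sum_rpow_le_card Finset.univ (fun i => norm_nonneg (x i))
        (by norm_num : (0 : ℝ) < 2) hpr
      rw [lpNorm_eq_sum hp hp', norm_eq_rpow_sum]
      simpa [ENNReal.toReal_inv] using h

lemma dHat_pos (hd : 1 ≤ d) : 0 < dHat p d := by
  have : (0 : ℝ) < d := by exact_mod_cast hd
  rw [dHat]
  split_ifs <;> positivity

lemma one_le_dTilde (hd : 1 ≤ d) : 1 ≤ dTilde p d := by
  rw [dTilde]
  split_ifs with h
  · exact le_rfl
  · refine Real.one_le_rpow (by exact_mod_cast hd) ?_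
    have h1 : p⁻¹ ≤ 2⁻¹ := ENNReal.inv_le_inv.2 (not_le.1 h).le
    have h2 := ENNReal.toReal_mono (by norm_num) h1
    rw [ENNReal.toReal_inv, ENNReal.toReal_inv] at h2
    rw [ENNReal.toReal_inv]
    norm_num at h2 ⊢
    exact h2

lemma lpNorm_add_le (hp : 1 ≤ p) (x y : Vec d) : lpNorm p (x + y) ≤ lpNorm p x + lpNorm p y := by
  have : Fact (1 ≤ p) := ⟨hp⟩
  exact norm_add_le (WithLp.toLp p (WithLp.ofLp x)) (WithLp.toLp p (WithLp.ofLp y))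

lemma lpNorm_smul (hp : 1 ≤ p) (a : ℝ) (x : Vec d) : lpNorm p (a • x) = |a| * lpNorm p x := by
  have : Fact (1 ≤ p) := ⟨hp⟩
  exact norm_smul a (WithLp.toLp p (WithLp.ofLp x))

lemma lpNorm_nonneg (hp : 1 ≤ p) (x : Vec d) : 0 ≤ lpNorm p x := by
  have : Fact (1 ≤ p) := ⟨hp⟩
  exact norm_nonneg _

end LpNorm

/-! ### The Laplacian of a connected network -/

section Laplacian

open Matrix

variable {n : ℕ} {A : Matrix (Fin n) (Fin n) ℝ}

lemma laplacian_mulVec (v : Fin n → ℝ) (i : Fin n) :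
    (laplacian A *ᵥ v) i = ∑ j, A i j * (v i - v j) := by
  rw [laplacian, sub_mulVec, Pi.sub_apply, mulVec_diagonal, Finset.sum_mul]
  simp only [mulVec, dotProduct, mul_sub, Finset.sum_sub_distrib]

lemma IsConnectedNetwork.dotProduct_laplacian (hA : IsConnectedNetwork A) (v : Fin n → ℝ) :
    v ⬝ᵥ (laplacian A *ᵥ v) = (1 / 2) * ∑ i, ∑ j, A i j * (v i - v j) ^ 2 := by
  have h1 : v ⬝ᵥ (laplacian A *ᵥ v) = ∑ i, ∑ j, A i j * (v i * (v i - v j)) := by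
    simp only [dotProduct, laplacian_mulVec, Finset.mul_sum]
    exact Finset.sum_congr rfl fun i _ => Finset.sum_congr rfl fun j _ => by ring
  have h2 : ∑ i, ∑ j, A i j * (v i * (v i - v j)) = ∑ i, ∑ j, A i j * (v j * (v j - v i)) := by
    rw [Finset.sum_comm]
    exact Finset.sum_congr rfl fun i _ => Finset.sum_congr rfl fun j _ => by rw [hA.symm]
  have h3 : ∑ i, ∑ j, A i j * (v i - v j) ^ 2
      = ∑ i, ∑ j, A i j * (v i * (v i - v j)) + ∑ i, ∑ j, A i j * (v j * (v j - v i)) := by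
    simp only [← Finset.sum_add_distrib]
    exact Finset.sum_congr rfl fun i _ => Finset.sum_congr rfl fun j _ => by ring
  rw [h1, h3, ← h2]
  ring

/-- The quadratic form is a sum of nonnegative edge terms, so its vanishing forces equality across
every edge, and equality propagates along walks. -/
lemma IsConnectedNetwork.eq_of_laplacian_mulVec_eq_zero (hA : IsConnectedNetwork A)
    {v : Fin n → ℝ} (hv : laplacian A *ᵥ v = 0) (i j : Fin n) : v i = v j := by
  have h := hA.dotProduct_laplacian v
  rw [hv, dotProduct_zero] at h
  have hterm : ∀ i j, 0 ≤ A i j * (v i - v j) ^ 2 := fun i j =>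
    mul_nonneg (hA.nonneg i j) (sq_nonneg _)
  have h0 : ∑ i, ∑ j, A i j * (v i - v j) ^ 2 = 0 := by linarith
  have h1 : ∀ i j, A i j * (v i - v j) ^ 2 = 0 := by
    intro i j
    rw [Finset.sum_eq_zero_iff_of_nonneg fun i _ => Finset.sum_nonneg fun j _ => hterm i j] at h0
    have h2 := h0 i (Finset.mem_univ i)
    rw [Finset.sum_eq_zero_iff_of_nonneg fun j _ => hterm i j] at h2
    exact h2 j (Finset.mem_univ j)
  have h2 : ∀ i j, 0 < A i j → v i = v j := fun i j hij => by
    have := (mul_eq_zero.1 (h1 i j)).resolve_left hij.ne'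
    exact sub_eq_zero.1 (pow_eq_zero_iff (by norm_num) |>.1 this)
  obtain ⟨w⟩ := hA.connected.preconnected i j
  induction w with
  | nil => rfl
  | cons hadj _ ih =>
    rw [SimpleGraph.fromRel_adj] at hadj
    refine Eq.trans ?_ ih
    rcases hadj.2 with h | h
    · exact h2 _ _ h
    · exact (h2 _ _ h).symm

lemma IsConnectedNetwork.pos (hA : IsConnectedNetwork A) : 0 < n := by
  obtain ⟨i⟩ := hA.connected.nonempty
  exact i.pos

lemma IsConnectedNetwork.isSymm_laplacian (hA : IsConnectedNetwork A) :
    (laplacian A)ᵀ = laplacian A := by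
  rw [laplacian, transpose_sub, diagonal_transpose]
  congr 1
  ext i j
  exact hA.symm j i

lemma laplacian_mul_avgMatrix : laplacian A * avgMatrix n = 0 := by
  ext i j
  have h := laplacian_mulVec (A := A) (fun _ => 1 / (n : ℝ)) i
  simpa [mulVec, dotProduct, mul_apply, avgMatrix] using h

lemma avgMatrix_transpose : (avgMatrix n)ᵀ = avgMatrix n := rfl

lemma IsConnectedNetwork.avgMatrix_mul_laplacian (hA : IsConnectedNetwork A) :
    avgMatrix n * laplacian A = 0 := by
  have h := congrArg transpose (laplacian_mul_avgMatrix (A := A))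
  rwa [transpose_mul, hA.isSymm_laplacian, avgMatrix_transpose, transpose_zero] at h

lemma avgMatrix_mul_self (hn : 0 < n) : avgMatrix n * avgMatrix n = avgMatrix n := by
  have : (n : ℝ) ≠ 0 := by exact_mod_cast hn.ne'
  ext i j
  simp only [mul_apply, avgMatrix, Finset.sum_const, Finset.card_univ, Fintype.card_fin,
    nsmul_eq_mul]
  field_simp

lemma mem_spectrum_of_mulVec_eq {M : Matrix (Fin n) (Fin n) ℝ} {v : Fin n → ℝ} (hv : v ≠ 0)
    {μ : ℝ} (h : M *ᵥ v = μ • v) : μ ∈ spectrum ℝ M := by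
  rw [spectrum.mem_iff, Matrix.isUnit_iff_isUnit_det, isUnit_iff_ne_zero, not_not,
    ← exists_mulVec_eq_zero_iff]
  refine ⟨v, hv, ?_⟩
  rw [sub_mulVec, h, Algebra.algebraMap_eq_smul_one, smul_mulVec, one_mulVec, sub_self]

lemma posSemidef_of_eigenvalue_nonneg {M : Matrix (Fin n) (Fin n) ℝ} (hM : Mᵀ = M)
    (h : ∀ (v : Fin n → ℝ) (μ : ℝ), v ≠ 0 → M *ᵥ v = μ • v → 0 ≤ μ) : M.PosSemidef := by
  have hH : M.IsHermitian := by
    rw [IsHermitian, conjTranspose_eq_transpose_of_trivial, hM]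
  rw [hH.posSemidef_iff_eigenvalues_nonneg]
  intro i
  refine h (WithLp.ofLp (hH.eigenvectorBasis i)) _ ?_ (hH.mulVec_eigenvectorBasis i)
  intro h0
  apply hH.eigenvectorBasis.orthonormal.ne_zero i
  exact (WithLp.ofLp_eq_zero 2).1 h0

variable {rho rho2 lam : ℝ}

/-- Applying the averaging matrix to the eigenvalue equation gives `(μ - lam) J v = 0`. Either `μ =
lam`, or `v` has mean zero and is an eigenvector of `L`; then `μ` is positive, because the kernel of
`L` consists of constants. -/
lemma IsConnectedNetwork.eigenvalue_mem_Icc (hA : IsConnectedNetwork A)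
    (hrho : IsGreatest ((fun μ : ℝ => |μ|) '' spectrum ℝ (laplacian A)) rho)
    (hrho2 : IsLeast {μ : ℝ | μ ∈ spectrum ℝ (laplacian A) ∧ 0 < μ} rho2)
    (hlam : rho2 ≤ lam) (hlam' : lam ≤ rho) {v : Fin n → ℝ} (hv : v ≠ 0) {μ : ℝ}
    (h : (laplacian A + lam • avgMatrix n) *ᵥ v = μ • v) : rho2 ≤ μ ∧ μ ≤ rho := by
  have hJ : (μ - lam) • (avgMatrix n *ᵥ v) = 0 := by
    have h1 := congrArg (fun u => avgMatrix n *ᵥ u) h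
    simp only [mulVec_mulVec, mul_add, hA.avgMatrix_mul_laplacian, mul_smul_comm,
      avgMatrix_mul_self hA.pos, zero_add, mulVec_smul, smul_mulVec] at h1
    rw [sub_smul, h1, sub_self]
  rcases smul_eq_zero.1 hJ with h0 | h0
  · rw [sub_eq_zero.1 h0]
    exact ⟨hlam, hlam'⟩
  · have hL : laplacian A *ᵥ v = μ • v := by
      rwa [add_mulVec, smul_mulVec, h0, smul_zero, add_zero] at h
    have hmem := mem_spectrum_of_mulVec_eq hv hL
    have hvv : 0 < v ⬝ᵥ v := by
      have := dotProduct_star_self_pos_iff.2 hv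
      simpa using this
    have hnonneg : 0 ≤ μ := by
      have h2 := hA.dotProduct_laplacian v
      rw [hL, dotProduct_smul, smul_eq_mul] at h2
      have h3 : 0 ≤ μ * (v ⬝ᵥ v) := by
        rw [h2]
        exact mul_nonneg (by norm_num) (Finset.sum_nonneg fun i _ => Finset.sum_nonneg fun j _ =>
          mul_nonneg (hA.nonneg i j) (sq_nonneg _))
      exact nonneg_of_mul_nonneg_left h3 hvv
    have hne : μ ≠ 0 := by
      rintro rfl
      rw [zero_smul] at hL
      apply hv
      ext i
      have h4 := congrFun h0 i
      simp only [mulVec, dotProduct, avgMatrix, Pi.zero_apply] at h4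
      rw [Finset.sum_congr rfl fun j _ => by
        rw [hA.eq_of_laplacian_mulVec_eq_zero hL j i]] at h4
      have : (n : ℝ) ≠ 0 := by exact_mod_cast hA.pos.ne'
      simpa [this] using h4
    refine ⟨hrho2.2 ⟨hmem, lt_of_le_of_ne hnonneg hne.symm⟩, ?_⟩
    exact (le_abs_self μ).trans (hrho.2 ⟨μ, hmem, rfl⟩)

lemma IsConnectedNetwork.transpose_shift (hA : IsConnectedNetwork A) (lam : ℝ) :
    (laplacian A + lam • avgMatrix n)ᵀ = laplacian A + lam • avgMatrix n := by
  rw [transpose_add, transpose_smul, hA.isSymm_laplacian, avgMatrix_transpose]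

lemma IsConnectedNetwork.posSemidef_shift_sub (hA : IsConnectedNetwork A)
    (hrho : IsGreatest ((fun μ : ℝ => |μ|) '' spectrum ℝ (laplacian A)) rho)
    (hrho2 : IsLeast {μ : ℝ | μ ∈ spectrum ℝ (laplacian A) ∧ 0 < μ} rho2)
    (hlam : rho2 ≤ lam) (hlam' : lam ≤ rho) :
    (laplacian A + lam • avgMatrix n - rho2 • 1).PosSemidef := by
  refine posSemidef_of_eigenvalue_nonneg ?_ fun v μ hv h => ?_
  · rw [transpose_sub, hA.transpose_shift, transpose_smul, transpose_one]
  · rw [sub_mulVec, sub_eq_iff_eq_add, smul_mulVec, one_mulVec, ← add_smul] at h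
    have := (hA.eigenvalue_mem_Icc hrho hrho2 hlam hlam' hv h).1
    linarith

lemma IsConnectedNetwork.posSemidef_sub_shift (hA : IsConnectedNetwork A)
    (hrho : IsGreatest ((fun μ : ℝ => |μ|) '' spectrum ℝ (laplacian A)) rho)
    (hrho2 : IsLeast {μ : ℝ | μ ∈ spectrum ℝ (laplacian A) ∧ 0 < μ} rho2)
    (hlam : rho2 ≤ lam) (hlam' : lam ≤ rho) :
    (rho • 1 - (laplacian A + lam • avgMatrix n)).PosSemidef := by
  refine posSemidef_of_eigenvalue_nonneg ?_ fun v μ hv h => ?_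
  · rw [transpose_sub, hA.transpose_shift, transpose_smul, transpose_one]
  · rw [sub_mulVec, sub_eq_iff_eq_add', smul_mulVec, one_mulVec, ← sub_eq_iff_eq_add,
      ← sub_smul] at h
    have := (hA.eigenvalue_mem_Icc hrho hrho2 hlam hlam' hv h.symm).2
    linarith

end Laplacian

/-! ### Stacked vectors -/

/-- Stacked vectors with their Euclidean norm. -/
abbrev Stacked (n d : ℕ) : Type := PiLp 2 (fun _ : Fin n => Vec d)

section Stacked

variable {n d : ℕ}

/-- `M ⊗ I_d` as a linear map. -/
def matOp (M : Matrix (Fin n) (Fin n) ℝ) : Stacked n d →ₗ[ℝ] Stacked n d where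
  toFun u := WithLp.toLp 2 (applyMat M (WithLp.ofLp u))
  map_add' u w := by
    ext i : 1
    simp [applyMat, Finset.sum_add_distrib]
  map_smul' a u := by
    ext i : 1
    simp [applyMat, Finset.smul_sum, smul_comm a]

lemma matOp_apply (M : Matrix (Fin n) (Fin n) ℝ) (u : Stacked n d) (i : Fin n) :
    matOp M u i = ∑ j, M i j • u j := rfl

lemma matOp_mul (M N : Matrix (Fin n) (Fin n) ℝ) (u : Stacked n d) :
    matOp (M * N) u = matOp M (matOp N u) := by
  ext i : 1
  simp only [matOp_apply, Matrix.mul_apply, Finset.sum_smul, Finset.smul_sum, smul_smul]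
  exact Finset.sum_comm

lemma matOp_one (u : Stacked n d) : matOp 1 u = u := by
  ext i : 1
  simp [matOp_apply, Matrix.one_apply]

lemma matOp_sub (M N : Matrix (Fin n) (Fin n) ℝ) (u : Stacked n d) :
    matOp (M - N) u = matOp M u - matOp N u := by
  ext i : 1
  simp [matOp_apply, sub_smul, Finset.sum_sub_distrib]

lemma matOp_smul (a : ℝ) (M : Matrix (Fin n) (Fin n) ℝ) (u : Stacked n d) :
    matOp (a • M) u = a • matOp M u := by
  ext i : 1
  simp [matOp_apply, Finset.smul_sum, smul_smul]

lemma inner_matOp (M : Matrix (Fin n) (Fin n) ℝ) (u w : Stacked n d) :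
    ⟪u, matOp M w⟫_ℝ = bilin M (WithLp.ofLp u) (WithLp.ofLp w) := by
  rw [PiLp.inner_apply]
  simp only [matOp_apply, inner_sum, real_inner_smul_right, bilin]

lemma inner_matOp_symm {M : Matrix (Fin n) (Fin n) ℝ} (hM : M.transpose = M) (u w : Stacked n d) :
    ⟪matOp M u, w⟫_ℝ = ⟪u, matOp M w⟫_ℝ := by
  rw [real_inner_comm, inner_matOp, inner_matOp, bilin, bilin, Finset.sum_comm]
  refine Finset.sum_congr rfl fun i _ => Finset.sum_congr rfl fun j _ => ?_
  rw [real_inner_comm, ← hM, Matrix.transpose_apply, hM]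

/-- `M ⊗ I_d` acts separately on each of the `d` coordinates, so its form is a sum of `d` copies of
the form of `M`. -/
lemma inner_matOp_nonneg {M : Matrix (Fin n) (Fin n) ℝ} (hM : M.PosSemidef) (u : Stacked n d) :
    0 ≤ ⟪u, matOp M u⟫_ℝ := by
  have h : ⟪u, matOp M u⟫_ℝ
      = ∑ l, (fun i => u i l) ⬝ᵥ (M.mulVec (fun i => u i l)) := by
    rw [inner_matOp]
    simp only [bilin, PiLp.inner_apply, dotProduct, Matrix.mulVec, Finset.mul_sum]
    rw [Finset.sum_comm' (t' := Finset.univ) (s' := fun _ => Finset.univ) (by simp),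
      Finset.sum_comm]
    refine Eq.trans ?_ Finset.sum_comm
    refine Finset.sum_congr rfl fun i _ => ?_
    refine Eq.trans ?_ Finset.sum_comm
    refine Finset.sum_congr rfl fun j _ => Finset.sum_congr rfl fun l _ => ?_
    simp
    ring
  rw [h]
  refine Finset.sum_nonneg fun l _ => ?_
  simpa using hM.dotProduct_mulVec_nonneg (fun i => u i l)

/-- The algebraic fields follow from `L J = J L = 0` and `J² = J`; the shifted Laplacian is
invertible because its eigenvalues are at least `rho2 > 0`. -/
theorem IsConnectedNetwork.isNetworkTriple {A : Matrix (Fin n) (Fin n) ℝ} {rho rho2 lam : ℝ}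
    (hA : IsConnectedNetwork A)
    (hrho : IsGreatest ((fun μ : ℝ => |μ|) '' spectrum ℝ (laplacian A)) rho)
    (hrho2 : IsLeast {μ : ℝ | μ ∈ spectrum ℝ (laplacian A) ∧ 0 < μ} rho2)
    (hlam : rho2 ≤ lam) (hlam' : lam ≤ rho) :
    IsNetworkTriple (H := Stacked n d) (matOp (matE n))
      (matOp (laplacian A + lam • avgMatrix n)) (matOp (matF A lam)) rho2 rho lam := by
  have hJJ := avgMatrix_mul_self hA.pos
  have hLJ := laplacian_mul_avgMatrix (A := A)
  have hJL := hA.avgMatrix_mul_laplacian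
  have hE : (matE n).transpose = matE n := by
    rw [matE, Matrix.transpose_sub, Matrix.transpose_one, avgMatrix_transpose]
  have hdet : IsUnit (laplacian A + lam • avgMatrix n).det := by
    rw [isUnit_iff_ne_zero]
    intro h0
    obtain ⟨v, hv, h⟩ := Matrix.exists_mulVec_eq_zero_iff.2 h0
    have h1 := (hA.eigenvalue_mem_Icc hrho hrho2 hlam hlam' hv (μ := 0) (by rw [h, zero_smul])).1
    exact absurd hrho2.1.2 (not_lt.2 h1)
  refine ⟨inner_matOp_symm hE, fun x => ?_, inner_matOp_symm (hA.transpose_shift lam),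
    fun x => ?_, fun x => ?_, fun x => ?_, fun x => ?_, fun x => ?_, fun x => ?_⟩
  · rw [← matOp_mul, matE, mul_sub, sub_mul, sub_mul, hJJ]
    simp
  · rw [← matOp_mul, ← matOp_mul, matE, mul_sub, sub_mul]
    simp [mul_add, add_mul, hLJ, hJL]
  · rw [← matOp_mul, matF, Matrix.mul_nonsing_inv _ hdet, matOp_one]
  · rw [← matOp_mul, matF, Matrix.nonsing_inv_mul _ hdet, matOp_one]
  · have h := inner_matOp_nonneg (hA.posSemidef_shift_sub hrho hrho2 hlam hlam') x
    rw [matOp_sub, matOp_smul, matOp_one, inner_sub_right, real_inner_smul_right,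
      real_inner_self_eq_norm_sq] at h
    linarith
  · have h := inner_matOp_nonneg (hA.posSemidef_sub_shift hrho hrho2 hlam hlam') x
    rw [matOp_sub, matOp_smul, matOp_one, inner_sub_right, real_inner_smul_right,
      real_inner_self_eq_norm_sq] at h
    linarith
  · have h : x - matOp (matE n) x = matOp (avgMatrix n) x := by
      rw [matE, matOp_sub, matOp_one, sub_sub_cancel]
    rw [h, ← matOp_mul, add_mul, hLJ, smul_mul_assoc, hJJ, zero_add, matOp_smul]

end Stacked

/-! ### One iteration of the algorithm -/

/-- The direction splits into four summands; this is the factor `4` in `psi3` and `psi4`. -/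
lemma IsNetworkTriple.norm_direction_sq_le {H : Type*} [NormedAddCommGroup H]
    [InnerProductSpace ℝ H] {E K F : H →ₗ[ℝ] H} {lo hi lam : ℝ}
    (N : IsNetworkTriple E K F lo hi lam) (hlo : 0 ≤ lo) (hhi : 0 < hi)
    {l b g : ℝ} (x e w h : H) (hh : ‖h‖ ≤ l * ‖E x‖) :
    ‖b • K (E (x - e)) + g • w + h‖ ^ 2
      ≤ 4 * ((b ^ 2 * hi ^ 2 + l ^ 2) * ‖E x‖ ^ 2 + g ^ 2 * hi * ⟪w, F w⟫_ℝ
        + b ^ 2 * hi ^ 2 * ‖e‖ ^ 2) := by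
  have hs : b • K (E (x - e)) + g • w + h = b • K (E x) + (-b) • K (E e) + g • w + h := by
    simp only [map_sub]
    module
  have h1 : ‖b • K (E x) + (-b) • K (E e) + g • w + h‖
      ≤ ‖b • K (E x)‖ + ‖(-b) • K (E e)‖ + ‖g • w‖ + ‖h‖ :=
    (norm_add_le _ _).trans (add_le_add_left ((norm_add_le _ _).trans
      (add_le_add_left (norm_add_le _ _) _)) _)
  have h2 : ‖b • K (E x) + (-b) • K (E e) + g • w + h‖ ^ 2
      ≤ 4 * (‖b • K (E x)‖ ^ 2 + ‖(-b) • K (E e)‖ ^ 2 + ‖g • w‖ ^ 2 + ‖h‖ ^ 2) := by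
    refine (pow_le_pow_left₀ (norm_nonneg _) h1 2).trans ?_
    set p := ‖b • K (E x)‖
    set q := ‖(-b) • K (E e)‖
    set r := ‖g • w‖
    set s := ‖h‖
    nlinarith [sq_nonneg (p - q), sq_nonneg (p - r), sq_nonneg (p - s), sq_nonneg (q - r),
      sq_nonneg (q - s), sq_nonneg (r - s)]
  rw [hs]
  refine h2.trans ?_
  simp only [norm_smul, mul_pow, Real.norm_eq_abs, sq_abs, neg_sq]
  have k1 := mul_le_mul_of_nonneg_left (N.norm_K_le hlo hhi (E x)) (sq_nonneg b)
  have k2 := mul_le_mul_of_nonneg_left (N.norm_K_le hlo hhi (E e)) (sq_nonneg b)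
  have k3 := mul_le_mul_of_nonneg_left
    (pow_le_pow_left₀ (norm_nonneg _) (N.norm_E_le e) 2) (by positivity : 0 ≤ b ^ 2 * hi ^ 2)
  have k4 := mul_le_mul_of_nonneg_left (N.norm_sq_le_inner_F hlo hhi w) (sq_nonneg g)
  have k5 := pow_le_pow_left₀ (norm_nonneg _) hh 2
  rw [mul_pow] at k5
  linarith

/-! ### Averages over the agents. -/

section Mean

variable {n d : ℕ}

lemma mean_add (x y : Fin n → Vec d) : mean (fun i => x i + y i) = mean x + mean y := by
  simp [mean, Finset.sum_add_distrib]

lemma mean_smul (a : ℝ) (x : Fin n → Vec d) : mean (fun i => a • x i) = a • mean x := by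
  simp only [mean, ← Finset.smul_sum]
  rw [smul_comm]

lemma mean_sub (x y : Fin n → Vec d) : mean (fun i => x i - y i) = mean x - mean y := by
  simp [mean, Finset.sum_sub_distrib, smul_sub]

lemma IsConnectedNetwork.mean_applyMat {A : Matrix (Fin n) (Fin n) ℝ} (hA : IsConnectedNetwork A)
    (u : Fin n → Vec d) : mean (applyMat (laplacian A) u) = 0 := by
  have h : ∀ j, ∑ i, laplacian A i j = 0 := fun j => by
    have hn : (n : ℝ) ≠ 0 := by exact_mod_cast hA.pos.ne'
    have h1 := congrFun (congrFun hA.avgMatrix_mul_laplacian j) j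
    simp only [Matrix.mul_apply, avgMatrix, ← Finset.mul_sum, Matrix.zero_apply] at h1
    exact (mul_eq_zero.1 h1).resolve_left (by simpa using hn)
  simp only [mean, applyMat]
  rw [Finset.sum_comm]
  simp only [← Finset.sum_smul, h, zero_smul, Finset.sum_const_zero, smul_zero]

lemma card_mul_norm_mean_sq_le (x : Fin n → Vec d) : n * ‖mean x‖ ^ 2 ≤ ∑ i, ‖x i‖ ^ 2 := by
  rcases Nat.eq_zero_or_pos n with rfl | hn
  · simp
  have hn' : (0 : ℝ) < n := by exact_mod_cast hn
  have h1 : ‖∑ i, x i‖ ^ 2 ≤ n * ∑ i, ‖x i‖ ^ 2 := by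
    refine (pow_le_pow_left₀ (norm_nonneg _) (norm_sum_le _ _) 2).trans ?_
    simpa using sq_sum_le_card_mul_sum_sq (s := Finset.univ) (f := fun i => ‖x i‖)
  have h2 : n * ‖mean x‖ ^ 2 = (n : ℝ)⁻¹ * ‖∑ i, x i‖ ^ 2 := by
    rw [mean, norm_smul, mul_pow, Real.norm_eq_abs, sq_abs]
    field_simp
  rw [h2, inv_mul_le_iff₀ hn']
  exact h1

lemma matOp_matE_apply (x : Stacked n d) (i : Fin n) :
    matOp (matE n) x i = x i - mean (WithLp.ofLp x) := by
  rw [matE, matOp_sub, matOp_one, PiLp.sub_apply, matOp_apply, mean, Finset.smul_sum]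
  rfl

lemma norm_matOp_matE_sq (x : Fin n → Vec d) :
    ‖matOp (matE n) (WithLp.toLp 2 x)‖ ^ 2 = ∑ i, ‖x i - mean x‖ ^ 2 := by
  rw [PiLp.norm_sq_eq_of_L2]
  exact Finset.sum_congr rfl fun i _ => by rw [matOp_matE_apply]

/-- The algorithm involves the singular `L`; behind `E` it may be replaced by the invertible shift.
-/
lemma IsConnectedNetwork.matOp_shift_matE {A : Matrix (Fin n) (Fin n) ℝ}
    (hA : IsConnectedNetwork A) (lam : ℝ) (u : Stacked n d) :
    matOp (laplacian A + lam • avgMatrix n) (matOp (matE n) u) = matOp (laplacian A) u := by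
  rw [← matOp_mul, matE, mul_sub]
  simp [add_mul, laplacian_mul_avgMatrix, avgMatrix_mul_self hA.pos]

end Mean

/-! ### Descent of the Lyapunov function in one update. -/

section Step

variable {n d : ℕ}

/-- The stacked dual error `w = v + ∇f(x̄) / γ`. -/
def dualError (c : Params) (f : Fin n → Vec d → ℝ) (x v : Fin n → Vec d) : Stacked n d :=
  WithLp.toLp 2 fun i => v i + (1 / c.gam) • ∇ (f i) (mean x)

/-- The stacked deviation of the local gradients from those at the average. -/
def gradError (f : Fin n → Vec d → ℝ) (x : Fin n → Vec d) : Stacked n d :=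
  WithLp.toLp 2 fun i => ∇ (f i) (x i) - ∇ (f i) (mean x)

lemma lyapunov_eq {c : Params} (hgam : c.gam ≠ 0) (A : Matrix (Fin n) (Fin n) ℝ) (lam : ℝ)
    (f : Fin n → Vec d → ℝ) (flow : ℝ) (x v : Fin n → Vec d) :
    c.lyapunov A lam f flow x v
      = energy (matOp (matE n)) (matOp (matF A lam)) (c.tau1 + 1) (WithLp.toLp 2 x)
          (dualError c f x v) + n * (globalCost f (mean x) - flow) := by
  have h : (c.beta + c.gam) / c.gam = c.tau1 + 1 := by
    rw [Params.beta]; field_simp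
  rw [energy, inner_matOp, inner_matOp, ← matOp_mul, inner_matOp, Params.lyapunov, h]
  rfl

lemma norm_gradError_le {f : Fin n → Vec d → ℝ} {l : ℝ} (hl : 0 ≤ l)
    (hlip : ∀ i x y, ‖∇ (f i) x - ∇ (f i) y‖ ≤ l * ‖x - y‖) (x : Fin n → Vec d) :
    ‖gradError f x‖ ≤ l * ‖matOp (matE n) (WithLp.toLp 2 x)‖ := by
  refine le_of_sq_le_sq ?_ (by positivity)
  rw [mul_pow, norm_matOp_matE_sq, PiLp.norm_sq_eq_of_L2, Finset.mul_sum]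
  refine Finset.sum_le_sum fun i _ => ?_
  rw [← mul_pow]
  exact pow_le_pow_left₀ (norm_nonneg _) (hlip i _ _) 2

/-- The primal variables move along the negative of this stacked direction. -/
lemma update_x_eq {c : Params} (hgam : c.gam ≠ 0) {A : Matrix (Fin n) (Fin n) ℝ}
    (hA : IsConnectedNetwork A) (lam α : ℝ) (f : Fin n → Vec d → ℝ) (z : State n d)
    (xhat : Fin n → Vec d) :
    WithLp.toLp 2 (z.update c α f xhat (applyMat (laplacian A) xhat)).x
      = WithLp.toLp 2 z.x - α • (c.beta • matOp (laplacian A + lam • avgMatrix n)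
          (matOp (matE n) (WithLp.toLp 2 z.x - WithLp.toLp 2 fun i => z.x i - xhat i))
          + c.gam • dualError c f z.x z.v + gradError f z.x) := by
  rw [hA.matOp_shift_matE]
  have h : (WithLp.toLp 2 z.x - WithLp.toLp 2 fun i => z.x i - xhat i : Stacked n d)
      = WithLp.toLp 2 xhat := by
    ext i : 1
    simp
  rw [h]
  ext i : 1
  -- `γ w` contains `∇f_i(x̄)`, which `gradError` completes to `∇f_i(x_i)`.
  have hα : α * c.gam * (1 / c.gam) = α := by field_simp
  simp only [State.update, PiLp.sub_apply, PiLp.smul_apply, PiLp.add_apply, dualError, gradError,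
    matOp_apply, applyMat, smul_add, smul_sub, smul_smul, hα]
  abel

/-- Both `L x̂` and `v` average to zero, so only the local gradients move the mean. -/
lemma mean_update_x {c : Params} {A : Matrix (Fin n) (Fin n) ℝ}
    (hA : IsConnectedNetwork A) (α : ℝ) (f : Fin n → Vec d → ℝ) (z : State n d)
    (hv : mean z.v = 0) (xhat : Fin n → Vec d) :
    mean (z.update c α f xhat (applyMat (laplacian A) xhat)).x
      = mean z.x - α • mean fun i => ∇ (f i) (z.x i) := by
  simp only [State.update]
  rw [mean_sub, mean_smul, mean_add, mean_add, mean_smul, mean_smul, hv, hA.mean_applyMat]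
  simp

lemma mean_update_v {c : Params} {A : Matrix (Fin n) (Fin n) ℝ}
    (hA : IsConnectedNetwork A) (α : ℝ) (f : Fin n → Vec d → ℝ) (z : State n d)
    (hv : mean z.v = 0) (xhat : Fin n → Vec d) :
    mean (z.update c α f xhat (applyMat (laplacian A) xhat)).v = 0 := by
  simp only [State.update]
  rw [mean_add, mean_smul, hv, hA.mean_applyMat]
  simp

lemma dualError_update {c : Params} {A : Matrix (Fin n) (Fin n) ℝ}
    (hA : IsConnectedNetwork A) (lam α : ℝ) (f : Fin n → Vec d → ℝ) (z : State n d)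
    (xhat : Fin n → Vec d) (x' : Fin n → Vec d) :
    dualError c f x' (z.update c α f xhat (applyMat (laplacian A) xhat)).v
      = dualError c f z.x z.v + (α * c.gam) • matOp (laplacian A + lam • avgMatrix n)
          (matOp (matE n) (WithLp.toLp 2 z.x - WithLp.toLp 2 fun i => z.x i - xhat i))
        + c.gam⁻¹ • WithLp.toLp 2 fun i => ∇ (f i) (mean x') - ∇ (f i) (mean z.x) := by
  rw [hA.matOp_shift_matE]
  have h : (WithLp.toLp 2 z.x - WithLp.toLp 2 fun i => z.x i - xhat i : Stacked n d)
      = WithLp.toLp 2 xhat := by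
    ext i : 1
    simp
  rw [h]
  ext i : 1
  simp only [State.update, PiLp.smul_apply, PiLp.add_apply, dualError,
    matOp_apply, applyMat, smul_sub, one_div]
  abel

/-- As `v` has mean zero, the consensus part of `w` is `∇f(x̄)/γ` at every agent. This converts the
excess `g² / 5 ‖w - E w‖²` of the energy estimate into a fifth of the squared gradient. -/
lemma norm_sq_dualError_sub {c : Params} {f : Fin n → Vec d → ℝ}
    (hgam : c.gam ≠ 0) (hf : ∀ i, Differentiable ℝ (f i)) (x v : Fin n → Vec d) (hv : mean v = 0) :
    c.gam ^ 2 * ‖dualError c f x v - matOp (matE n) (dualError c f x v)‖ ^ 2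
      = n * ‖∇ (globalCost f) (mean x)‖ ^ 2 := by
  have h : mean (fun i => v i + (1 / c.gam) • ∇ (f i) (mean x))
      = (1 / c.gam) • ∇ (globalCost f) (mean x) := by
    rw [mean_add, mean_smul, hv, zero_add, gradient_globalCost hf, mean]
  rw [PiLp.norm_sq_eq_of_L2]
  simp only [PiLp.sub_apply, matOp_matE_apply, sub_sub_cancel, Finset.sum_const,
    Finset.card_univ, Fintype.card_fin, nsmul_eq_mul]
  rw [dualError, h, norm_smul, mul_pow, Real.norm_eq_abs, sq_abs]
  field_simp

/-- The Lyapunov function decreases up to the compression error. -/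
theorem lyapunov_update_le {c : Params} {A : Matrix (Fin n) (Fin n) ℝ} {lam : ℝ}
    (hA : IsConnectedNetwork A)
    (N : IsNetworkTriple (H := Stacked n d) (matOp (matE n))
      (matOp (laplacian A + lam • avgMatrix n)) (matOp (matF A lam)) c.rho2 c.rho lam)
    (hrho2 : 0 < c.rho2) (hlam : c.rho2 ≤ lam) (hlam' : lam ≤ c.rho) (hell : 0 < c.ell)
    (htau1 : 0 ≤ c.tau1) (hgam : 0 < c.gam) (hgr : 5 ≤ c.gam * c.rho2)
    {f : Fin n → Vec d → ℝ} (hf : ∀ i, Differentiable ℝ (f i))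
    (hlip : ∀ i x y, ‖∇ (f i) x - ∇ (f i) y‖ ≤ c.ell * ‖x - y‖)
    {α : ℝ} (hα : 0 ≤ α) (h1 : α * c.phi2 ≤ c.phi1) (h3 : α * c.phi4 ≤ c.phi3)
    (h5 : α * c.phi6 ≤ c.phi5) (flow : ℝ) (z : State n d) (hv : mean z.v = 0)
    (xhat : Fin n → Vec d) (z' : State n d)
    (hz' : z' = z.update c α f xhat (applyMat (laplacian A) xhat)) :
    c.lyapunov A lam f flow z'.x z'.v
      ≤ c.lyapunov A lam f flow z.x z.v
        - α * ((3 / 10) * n * ‖∇ (globalCost f) (mean z.x)‖ ^ 2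
          + c.ell ^ 2 / 20 * ∑ i, ‖z.x i - mean z.x‖ ^ 2)
        + α * c.psi2 α * ∑ i, ‖z.x i - xhat i‖ ^ 2 := by
  have hgam' := hgam.ne'
  set g : Vec d := mean fun i => ∇ (f i) (z.x i) with hg
  set D : Stacked n d := WithLp.toLp 2 fun i => ∇ (f i) (mean z'.x) - ∇ (f i) (mean z.x) with hD
  set e : Stacked n d := WithLp.toLp 2 fun i => z.x i - xhat i with he
  set X : Stacked n d := WithLp.toLp 2 z.x with hX
  have hn : (0 : ℝ) ≤ n := Nat.cast_nonneg n
  have hmean : mean z'.x = mean z.x + -(α • g) := by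
    rw [hz', mean_update_x hA α f z hv, sub_eq_add_neg]
  have hh := norm_gradError_le hell.le hlip z.x
  have hDn : ‖D‖ ≤ c.ell * (α * (√n * ‖g‖)) := by
    refine le_of_sq_le_sq ?_ (by positivity)
    rw [PiLp.norm_sq_eq_of_L2]
    refine (Finset.sum_le_card_nsmul _ _ ((c.ell * (α * ‖g‖)) ^ 2) fun i _ => ?_).trans ?_
    · refine pow_le_pow_left₀ (norm_nonneg _) ((hlip i _ _).trans (le_of_eq ?_)) 2
      rw [hmean, add_sub_cancel_left, norm_neg, norm_smul, Real.norm_of_nonneg hα]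
    · simp only [mul_pow, Real.sq_sqrt hn, Finset.card_univ, Fintype.card_fin, nsmul_eq_mul]
      exact le_of_eq (by ring)
  have hen : ‖e‖ ^ 2 = ∑ i, ‖z.x i - xhat i‖ ^ 2 := PiLp.norm_sq_eq_of_L2 _ _
  have hXn : ‖matOp (matE n) X‖ ^ 2 = ∑ i, ‖z.x i - mean z.x‖ ^ 2 := norm_matOp_matE_sq _
  have hJn := norm_sq_dualError_sub hgam' hf z.x z.v hv
  have key := N.energy_step_le hrho2 hlam hlam' hell htau1 hgam hgr hα
    (by positivity : 0 ≤ √n * ‖g‖) X e (dualError c f z.x z.v) (gradError f z.x) D hh hDn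
  have hx' := update_x_eq hgam' hA lam α f z xhat
  have hw' := dualError_update hA lam α f z xhat z'.x (c := c)
  rw [← hz'] at hx' hw'
  rw [← hx', ← hw', mul_pow, Real.sq_sqrt hn] at key
  have hcost := le_add_inner_gradient_add
    (fun x => (hasGradientAt_globalCost hf x).differentiableAt)
    (gradient_globalCost_lipschitz hA.pos hf hlip) (mean z.x) (-(α • g))
  rw [← hmean, inner_neg_right, real_inner_smul_right, norm_neg, norm_smul, mul_pow,
    Real.norm_eq_abs, sq_abs] at hcost
  -- Expanding this square replaces `-⟪∇f, g⟫` by `-‖∇f‖²/2 - ‖g‖²/2` plus half the consensus error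
  -- times `ℓ²`.
  have hcross : n * ‖g - ∇ (globalCost f) (mean z.x)‖ ^ 2
      ≤ c.ell ^ 2 * ‖matOp (matE n) X‖ ^ 2 := by
    have k1 : g - ∇ (globalCost f) (mean z.x)
        = mean fun i => ∇ (f i) (z.x i) - ∇ (f i) (mean z.x) := by
      rw [mean_sub, gradient_globalCost hf]
      rfl
    have k2 := card_mul_norm_mean_sq_le fun i => ∇ (f i) (z.x i) - ∇ (f i) (mean z.x)
    have k3 := pow_le_pow_left₀ (norm_nonneg _) hh 2
    rw [mul_pow, PiLp.norm_sq_eq_of_L2] at k3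
    rw [k1]
    exact k2.trans k3
  rw [norm_sub_sq_real, real_inner_comm] at hcross
  have hW := N.inner_F_nonneg hrho2 (dualError c f z.x z.v)
  -- Final balance: `1/2 - 1/5 = 3/10` for the gradient, `11/20 - 1/2 = 1/20` for the consensus
  -- error, and `9/40 - 1/2 < 0` for `‖g‖²`.
  have m1 := mul_nonneg (mul_nonneg hα (sub_nonneg.2 h1)) (sq_nonneg ‖matOp (matE n) X‖)
  have m3 := mul_nonneg (mul_nonneg hα (sub_nonneg.2 h3)) hW
  have m5 := mul_nonneg (mul_nonneg hα (sub_nonneg.2 h5)) (mul_nonneg hn (sq_nonneg ‖g‖))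
  have m6 := mul_nonneg hα (mul_nonneg hn (sq_nonneg ‖g‖))
  have m7 := mul_le_mul_of_nonneg_left hcost hn
  have m8 := mul_le_mul_of_nonneg_left hcross hα
  have m9 := congrArg (fun t => α * t) hJn
  rw [lyapunov_eq hgam', lyapunov_eq hgam', ← hen, ← hXn]
  linarith

end Step

/-! ### Elementary facts on the parameters -/

/-- The inequalities between the parameters that the analysis of one iteration uses. -/
structure Params.Admissible (c : Params) : Prop where
  ell_pos : 0 < c.ell
  C_pos : 0 < c.C
  r_pos : 0 < c.r
  del_pos : 0 < c.del
  del_le : c.del ≤ 1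
  om_pos : 0 < c.om
  om_le : c.om * c.r ≤ 1
  rho2_pos : 0 < c.rho2
  rho2_le : c.rho2 ≤ c.rho
  tau1_mul : 1 < c.tau1 * c.rho2
  gam_pos : 0 < c.gam
  gam_mul : 5 ≤ c.gam * c.rho2
  dhat_pos : 0 < c.dhat
  kappaHat0_pos : 0 < c.kappaHat0
  tau0_pos : 0 < c.tau0

namespace Params.Admissible

variable {c : Params}

lemma rho_pos (h : c.Admissible) : 0 < c.rho := h.rho2_pos.trans_le h.rho2_le

lemma tau1_pos (h : c.Admissible) : 0 < c.tau1 := by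
  by_contra hneg
  nlinarith [h.tau1_mul, h.rho2_pos]

lemma beta_pos (h : c.Admissible) : 0 < c.beta := mul_pos h.tau1_pos h.gam_pos

lemma eps1_pos (h : c.Admissible) : 0 < c.eps1 := by
  have := h.tau1_pos
  have := h.rho2_pos
  have := sub_pos.2 h.tau1_mul
  rw [Params.eps1]
  positivity

lemma eps5_pos (h : c.Admissible) : 0 < c.eps5 := by
  have h1 : 0 < c.del - c.del ^ 2 / 2 := by nlinarith [h.del_pos, h.del_le]
  exact mul_pos (mul_pos h.om_pos h.r_pos) h1

lemma eps5_le (h : c.Admissible) : c.eps5 ≤ 1 / 2 := by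
  have h1 : c.del - c.del ^ 2 / 2 ≤ 1 / 2 := by nlinarith [sq_nonneg (c.del - 1)]
  have h2 : 0 ≤ c.om * c.r := (mul_pos h.om_pos h.r_pos).le
  rw [Params.eps5]
  nlinarith [mul_le_mul_of_nonneg_left h1 h2, h.om_le]

lemma eps8_pos (h : c.Admissible) : 0 < c.eps8 := by
  have := h.eps5_pos
  rw [Params.eps8]
  positivity

lemma eps8_le (h : c.Admissible) : c.eps8 ≤ 1 := by
  rw [Params.eps8]
  nlinarith [h.eps5_pos, h.eps5_le]

lemma psi3_nonneg (h : c.Admissible) : 0 ≤ c.psi3 := by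
  have := h.eps5_pos
  rw [Params.psi3]
  positivity

lemma psi4_pos (h : c.Admissible) : 0 < c.psi4 := by
  have := h.eps5_pos
  have := h.eps1_pos
  have := h.dhat_pos
  have : 0 < max (c.beta ^ 2 * c.rho ^ 2 + c.ell ^ 2) (c.gam ^ 2 * c.rho) := by
    refine lt_max_of_lt_right ?_
    have := h.gam_pos
    have := h.rho_pos
    positivity
  rw [Params.psi4]
  positivity

lemma phi2_pos (h : c.Admissible) : 0 < c.phi2 := by
  have h1 : c.rho2 * c.beta * c.gam ≤ c.rho * c.beta * c.gam := by
    have := h.beta_pos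
    have := h.gam_pos
    have := h.rho2_le
    gcongr
  have h2 := mul_nonneg h.rho_pos.le (sq_nonneg c.gam)
  rw [Params.phi2]
  nlinarith [sq_nonneg (c.rho * c.beta - c.gam / 2), sq_nonneg (c.rho * c.beta),
    sq_nonneg c.gam, sq_nonneg c.ell]

lemma phi4_pos (h : c.Admissible) : 0 < c.phi4 := by
  have := h.rho_pos
  rw [Params.phi4]
  positivity

lemma phi6_pos (h : c.Admissible) : 0 < c.phi6 := by
  have := h.ell_pos
  have := h.gam_pos
  have := h.beta_pos
  have := h.rho2_pos
  rw [Params.phi6]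
  positivity

lemma psi2_nonneg (h : c.Admissible) {α : ℝ} (hα : 0 ≤ α) : 0 ≤ c.psi2 α := by
  have hb := h.beta_pos
  have hg := h.gam_pos
  have hr := h.rho_pos
  have h1 : c.rho2 * c.beta * c.gam ≤ c.rho * c.beta * c.gam := by
    have := h.rho2_le
    gcongr
  have h2 := mul_nonneg hr.le (sq_nonneg c.gam)
  have h7 : 0 ≤ c.phi7 := by
    rw [Params.phi7]
    positivity
  have h8 : 0 ≤ c.phi8 := by
    rw [Params.phi8]
    nlinarith [sq_nonneg (c.rho * c.beta - c.gam / 2), sq_nonneg (c.rho * c.beta),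
      sq_nonneg c.gam]
  exact add_nonneg h7 (mul_nonneg hα h8)

lemma kappa7_pos (h : c.Admissible) : 0 < c.kappa7 :=
  lt_min h.kappaHat0_pos (by have := h.ell_pos; positivity)

lemma mul_phi_le (h : c.Admissible) {α : ℝ} (hα : α ≤ c.kappa7) :
    α * c.phi2 ≤ c.phi1 ∧ α * c.phi4 ≤ c.phi3 ∧ α * c.phi6 ≤ c.phi5 := by
  have h0 : α ≤ c.kappaHat0 := hα.trans (min_le_left _ _)
  refine ⟨?_, ?_, ?_⟩
  · exact (le_div_iff₀ h.phi2_pos).1 (h0.trans (min_le_left _ _))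
  · exact (le_div_iff₀ h.phi4_pos).1 (h0.trans ((min_le_right _ _).trans (min_le_left _ _)))
  · exact (le_div_iff₀ h.phi6_pos).1 (h0.trans ((min_le_right _ _).trans (min_le_right _ _)))

end Params.Admissible

/-! ### The stepsize -/

section Stepsize

variable {c : Params} {n T : ℕ} {dt : ℝ}

lemma rpow_one_third_pow {x : ℝ} (hx : 0 ≤ x) : (x ^ (1 / 3 : ℝ)) ^ 3 = x := by
  rw [← Real.rpow_natCast, ← Real.rpow_mul hx]
  norm_num

lemma stepsize_pos (hτ : 0 < c.tau0) (hn : 0 < n) (hdt : 0 < dt) (hT : 0 < T) :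
    0 < c.stepsize n dt T := by
  have : (0 : ℝ) < n := by exact_mod_cast hn
  have : (0 : ℝ) < T := by exact_mod_cast hT
  rw [Params.stepsize]
  positivity

/-- The normalization that makes the accumulated compression error over `T` iterations independent
of `n`, `d̃` and `T`, relative to `s_0²`. -/
lemma stepsize_pow_three (hn : 0 < n) (hdt : 0 < dt) (hT : 0 < T) :
    c.stepsize n dt T ^ 3 * (n * dt ^ 2 * T) = c.tau0 ^ 3 := by
  have hn' : (0 : ℝ) < n := by exact_mod_cast hn
  have hT' : (0 : ℝ) < T := by exact_mod_cast hT
  have h2 : (dt ^ (2 / 3 : ℝ)) ^ 3 = dt ^ 2 := by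
    rw [← Real.rpow_natCast, ← Real.rpow_mul hdt.le, ← Real.rpow_natCast]
    norm_num
  rw [Params.stepsize, div_pow, mul_pow, mul_pow, rpow_one_third_pow hn'.le,
    rpow_one_third_pow hT'.le, h2]
  field_simp

/-- The claimed rate is `τ₀ / (α T)`, so telescoping yields it directly. -/
lemma stepsize_mul (hn : 0 < n) (hdt : 0 < dt) (hT : 0 < T) :
    c.stepsize n dt T * T * ((n : ℝ) ^ (1 / 3 : ℝ) * dt ^ (2 / 3 : ℝ) / (T : ℝ) ^ (2 / 3 : ℝ))
      = c.tau0 := by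
  have hn' : (0 : ℝ) < n := by exact_mod_cast hn
  have hT' : (0 : ℝ) < T := by exact_mod_cast hT
  have h : (T : ℝ) = (T : ℝ) ^ (1 / 3 : ℝ) * (T : ℝ) ^ (2 / 3 : ℝ) := by
    rw [← Real.rpow_add hT']
    norm_num
  have h1 : (0 : ℝ) < (T : ℝ) ^ (1 / 3 : ℝ) := by positivity
  have h2 : (0 : ℝ) < (T : ℝ) ^ (2 / 3 : ℝ) := by positivity
  have h3 : (0 : ℝ) < (n : ℝ) ^ (1 / 3 : ℝ) := by positivity
  have h4 : (0 : ℝ) < dt ^ (2 / 3 : ℝ) := by positivity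
  rw [Params.stepsize]
  nth_rewrite 2 [h]
  field_simp

lemma Params.Admissible.horizon_pos (h : c.Admissible) (hn : 0 < n) (hdt : 0 < dt)
    (hT : c.kappa3 n dt < T) : 0 < T := by
  have hn' : (0 : ℝ) < n := by exact_mod_cast hn
  have h7 := h.kappa7_pos
  have hτ := h.tau0_pos
  have h1 : 0 < c.tau0 ^ 3 / ((n : ℝ) * dt ^ 2 * c.kappa7 ^ 3) := by positivity
  have h2 : (0 : ℝ) < T := (h1.trans_le (le_max_left _ _)).trans hT
  exact_mod_cast h2

lemma Params.Admissible.stepsize_le (h : c.Admissible) (hn : 0 < n) (hdt : 0 < dt)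
    (hT : c.kappa3 n dt < T) : c.stepsize n dt T ≤ c.kappa7 := by
  have hn' : (0 : ℝ) < n := by exact_mod_cast hn
  have hT0 := h.horizon_pos hn hdt hT
  have hT' : (0 : ℝ) < T := by exact_mod_cast hT0
  have h7 := h.kappa7_pos
  have h1 := (le_max_left _ _).trans_lt hT
  rw [div_lt_iff₀ (by positivity), ← stepsize_pow_three hn hdt hT0] at h1
  have h2 : c.stepsize n dt T ^ 3 ≤ c.kappa7 ^ 3 := by
    refine le_of_mul_le_mul_right ?_ (by positivity : 0 < n * dt ^ 2 * T)
    linarith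
  exact le_of_pow_le_pow_left₀ (by norm_num) h7.le h2

/-- The second entry of `kappa3` is this inequality solved for `T`. Comparing cubes, with the bound
on `T` squared, removes the fractional powers. -/
lemma Params.Admissible.psi3_mul_le (h : c.Admissible) (hn : 0 < n) (hdt : 0 < dt)
    (hT : c.kappa3 n dt < T) :
    (1 - 2 * c.eps5) * c.psi3 * c.stepsize n dt T ^ 2 * (n * dt ^ 2) ≤ c.eps8 := by
  have hn' : (0 : ℝ) < n := by exact_mod_cast hn
  have hT0 := h.horizon_pos hn hdt hT
  have hT' : (0 : ℝ) < T := by exact_mod_cast hT0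
  have hτ := h.tau0_pos
  have h8 := h.eps8_pos
  have hα := stepsize_pos (c := c) hτ hn hdt hT0
  have hα3 := stepsize_pow_three (c := c) hn hdt hT0
  set α := c.stepsize n dt T
  set P := (1 - 2 * c.eps5) * c.psi3 with hP
  have hP0 : 0 ≤ P := mul_nonneg (by linarith [h.eps5_le]) h.psi3_nonneg
  set Y := P * c.tau0 ^ 2 / c.eps8 with hY
  have hY0 : 0 ≤ Y := by positivity
  have h1 := (le_max_right _ _).trans_lt hT
  have h2 : Y ^ 3 * (n * dt ^ 2) ≤ (T : ℝ) ^ 2 := by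
    have h3 := pow_le_pow_left₀ (by positivity) h1.le 2
    have e1 : (Y ^ (3 / 2 : ℝ)) ^ 2 = Y ^ 3 := by
      rw [← Real.rpow_natCast, ← Real.rpow_mul hY0, ← Real.rpow_natCast]
      norm_num
    have e2 : ((n : ℝ) ^ (1 / 2 : ℝ)) ^ 2 = n := by
      rw [← Real.rpow_natCast, ← Real.rpow_mul hn'.le]
      norm_num
    rw [mul_pow, mul_pow, e1, e2] at h3
    linarith
  have h4 : (Y * (α ^ 2 * (n * dt ^ 2))) ^ 3 ≤ (c.tau0 ^ 2) ^ 3 := by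
    have e3 : (c.tau0 ^ 2) ^ 3 = (α ^ 3 * (n * dt ^ 2 * T)) ^ 2 := by rw [hα3]; ring
    have h5 := mul_le_mul_of_nonneg_left h2 (by positivity : 0 ≤ α ^ 6 * (n * dt ^ 2) ^ 2)
    rw [e3]
    linarith
  have h6 : Y * (α ^ 2 * (n * dt ^ 2)) ≤ c.tau0 ^ 2 :=
    le_of_pow_le_pow_left₀ (by norm_num) (by positivity) h4
  rw [hY, div_mul_eq_mul_div, div_le_iff₀ h8] at h6
  refine le_of_mul_le_mul_left ?_ (by positivity : 0 < c.tau0 ^ 2)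
  linarith

end Stepsize

/-! ### The compression error -/

section Compression

variable {d : ℕ} {p : ℝ≥0∞} {c : Params}

/-- The remainder is `(1 - ωr) u` minus `ωr s` times the deviation of the compressor at `u / s`. As
`ωr ≤ 1`, the factors combine to `1 - ωrδ`, whose square is at most `1 - 2ωrδ + ωrδ² = 1 - 2ε₅`. -/
lemma Params.Admissible.lpNorm_compress_sq_le (h : c.Admissible) (hp : 1 ≤ p)
    {comp : Vec d → Vec d} (hcomp : LocallyBounded p c.C c.r c.del comp) {s : ℝ} (hs : 0 < s)
    {u : Vec d} (hu : lpNorm p u ^ 2 ≤ c.C ^ 2 * s ^ 2) :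
    lpNorm p (u - (c.om * s) • comp ((1 / s) • u)) ^ 2
      ≤ c.C ^ 2 * s ^ 2 * (1 - 2 * c.eps5) := by
  have hC := h.C_pos
  have hr := h.r_pos
  have hom := h.om_pos
  have hu' : lpNorm p u ≤ c.C * s := by
    refine le_of_sq_le_sq ?_ (by positivity)
    rwa [mul_pow]
  have h1 : lpNorm p ((1 / s) • u) ≤ c.C := by
    rw [lpNorm_smul hp, abs_of_pos (by positivity), one_div, inv_mul_le_iff₀ hs]
    linarith
  have h2 := hcomp _ h1
  have e1 : u - (c.om * s) • comp ((1 / s) • u)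
      = (1 - c.om * c.r) • u
        + (-(c.om * c.r * s)) • ((1 / c.r) • comp ((1 / s) • u) - (1 / s) • u) := by
    have k1 : c.om * c.r * s * (1 / c.r) = c.om * s := by field_simp
    have k2 : c.om * c.r * s * (1 / s) = c.om * c.r := by field_simp
    rw [smul_sub, smul_smul, smul_smul, neg_mul, neg_mul, k1, k2]
    module
  have h3 : lpNorm p (u - (c.om * s) • comp ((1 / s) • u))
      ≤ c.C * s * (1 - c.om * c.r * c.del) := by
    rw [e1]
    refine (lpNorm_add_le hp _ _).trans ?_
    rw [lpNorm_smul hp, lpNorm_smul hp, abs_of_nonneg (sub_nonneg.2 h.om_le), abs_neg,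
      abs_of_pos (by positivity)]
    have k3 := mul_le_mul_of_nonneg_left hu' (sub_nonneg.2 h.om_le)
    have k4 := mul_le_mul_of_nonneg_left h2 (by positivity : 0 ≤ c.om * c.r * s)
    linarith
  have h4 := pow_le_pow_left₀ (lpNorm_nonneg hp _) h3 2
  have h5 : (1 - c.om * c.r * c.del) ^ 2 ≤ 1 - 2 * c.eps5 := by
    have k5 : 0 ≤ c.om * c.r * (1 - c.om * c.r) * c.del ^ 2 :=
      mul_nonneg (mul_nonneg (by positivity) (sub_nonneg.2 h.om_le)) (sq_nonneg _)
    rw [Params.eps5]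
    linarith
  have h6 := mul_le_mul_of_nonneg_left h5 (by positivity : 0 ≤ c.C ^ 2 * s ^ 2)
  linarith

/-- Young's inequality for the `ℓ_p` norm of the innovation. -/
lemma Params.Admissible.lpNorm_innovation_sq_le (h : c.Admissible) (hp : 1 ≤ p)
    (hd : c.dhat = dHat p d) (e m : Vec d) :
    lpNorm p (m + e) ^ 2
      ≤ (1 + c.eps5) * lpNorm p e ^ 2 + (1 + c.eps5⁻¹) * c.dhat ^ 2 * ‖m‖ ^ 2 := by
  have h5 := h.eps5_pos
  have h1 := pow_le_pow_left₀ (lpNorm_nonneg hp _) (lpNorm_add_le hp m e) 2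
  have h2 := pow_le_pow_left₀ (lpNorm_nonneg hp m) (lpNorm_le_dHat_mul hp m) 2
  rw [← hd, mul_pow] at h2
  have h3 := mul_le_mul_of_nonneg_left h2 (by positivity : 0 ≤ 1 + c.eps5⁻¹)
  have h4 : 2 * lpNorm p m * lpNorm p e ≤ c.eps5 * lpNorm p e ^ 2 + c.eps5⁻¹ * lpNorm p m ^ 2 := by
    have k : c.eps5 * lpNorm p e ^ 2 + c.eps5⁻¹ * lpNorm p m ^ 2 - 2 * lpNorm p m * lpNorm p e
        = c.eps5⁻¹ * (lpNorm p m - c.eps5 * lpNorm p e) ^ 2 := by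
      field_simp
      ring
    have : 0 ≤ c.eps5⁻¹ * (lpNorm p m - c.eps5 * lpNorm p e) ^ 2 := by positivity
    linarith
  linarith

end Compression

/-! ### Bounds along a run -/

section Run

variable {n d : ℕ} {p : ℝ≥0∞} {c : Params} {A : Matrix (Fin n) (Fin n) ℝ} {lam α : ℝ}
  {f : Fin n → Vec d → ℝ}

lemma Params.Admissible.le_lyapunov (h : c.Admissible)
    (N : IsNetworkTriple (H := Stacked n d) (matOp (matE n))
      (matOp (laplacian A + lam • avgMatrix n)) (matOp (matF A lam)) c.rho2 c.rho lam)
    (flow : ℝ) (x v : Fin n → Vec d) :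
    c.eps1 * (‖matOp (matE n) (WithLp.toLp 2 x)‖ ^ 2
        + ⟪dualError c f x v, matOp (matF A lam) (dualError c f x v)⟫_ℝ)
      + n * (globalCost f (mean x) - flow) ≤ c.lyapunov A lam f flow x v := by
  rw [lyapunov_eq h.gam_pos.ne']
  exact add_le_add_left (N.le_energy h.rho2_pos h.tau1_mul _ _) _

/-- One agent's displacement is at most the stacked one, whose energy part is controlled by the
Lyapunov value because the gap is nonnegative. The prefactor is the one from Young's inequality for
the innovation. -/
lemma Params.Admissible.movement_le (h : c.Admissible) (hA : IsConnectedNetwork A)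
    (N : IsNetworkTriple (H := Stacked n d) (matOp (matE n))
      (matOp (laplacian A + lam • avgMatrix n)) (matOp (matF A lam)) c.rho2 c.rho lam)
    (hlip : ∀ i x y, ‖∇ (f i) x - ∇ (f i) y‖ ≤ c.ell * ‖x - y‖)
    {flow : ℝ} (z : State n d) (hflow : flow ≤ globalCost f (mean z.x)) (xhat : Fin n → Vec d)
    (i : Fin n) :
    (1 + c.eps5⁻¹) * c.dhat ^ 2
        * ‖(z.update c α f xhat (applyMat (laplacian A) xhat)).x i - z.x i‖ ^ 2
      ≤ α ^ 2 * (c.psi4 * c.lyapunov A lam f flow z.x z.v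
        + c.psi3 * ∑ i, ‖z.x i - xhat i‖ ^ 2) := by
  have h5 := h.eps5_pos
  have h1 := h.eps1_pos
  set z' := z.update c α f xhat (applyMat (laplacian A) xhat) with hz'
  set w := dualError c f z.x z.v with hw
  set e : Stacked n d := WithLp.toLp 2 fun i => z.x i - xhat i with he
  set X : Stacked n d := WithLp.toLp 2 z.x with hX
  have hx' := update_x_eq h.gam_pos.ne' hA lam α f z xhat
  rw [← hz', ← hw, ← hX, ← he] at hx'
  have hen : ‖e‖ ^ 2 = ∑ i, ‖z.x i - xhat i‖ ^ 2 := PiLp.norm_sq_eq_of_L2 _ _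
  have hdir := N.norm_direction_sq_le h.rho2_pos.le h.rho_pos (b := c.beta) (g := c.gam) X e w
    (gradError f z.x) (norm_gradError_le h.ell_pos.le hlip z.x)
  have hmove : ‖z'.x i - z.x i‖ ^ 2 ≤ α ^ 2 * ‖c.beta • matOp (laplacian A + lam • avgMatrix n)
      (matOp (matE n) (X - e)) + c.gam • w + gradError f z.x‖ ^ 2 := by
    have k1 := PiLp.norm_apply_le (WithLp.toLp 2 z'.x - X) i
    have k2 := pow_le_pow_left₀ (norm_nonneg _) k1 2
    refine k2.trans (le_of_eq ?_)
    rw [hx', sub_sub_cancel_left, norm_neg, norm_smul, mul_pow, Real.norm_eq_abs, sq_abs]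
  have hV := h.le_lyapunov N flow z.x z.v (f := f)
  have hgap : 0 ≤ n * (globalCost f (mean z.x) - flow) :=
    mul_nonneg (Nat.cast_nonneg n) (sub_nonneg.2 hflow)
  set W := ⟪w, matOp (matF A lam) w⟫_ℝ with hW
  have hW0 : 0 ≤ W := N.inner_F_nonneg h.rho2_pos w
  set m := max (c.beta ^ 2 * c.rho ^ 2 + c.ell ^ 2) (c.gam ^ 2 * c.rho) with hm
  have hm0 : 0 ≤ m := le_max_of_le_left (by positivity)
  have j1 := mul_le_mul_of_nonneg_right
    (le_max_left (c.beta ^ 2 * c.rho ^ 2 + c.ell ^ 2) (c.gam ^ 2 * c.rho))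
    (sq_nonneg ‖matOp (matE n) X‖)
  have j2 := mul_le_mul_of_nonneg_right
    (le_max_right (c.beta ^ 2 * c.rho ^ 2 + c.ell ^ 2) (c.gam ^ 2 * c.rho)) hW0
  rw [← hm] at j1 j2
  have j3 : m * (‖matOp (matE n) X‖ ^ 2 + W)
      ≤ m / c.eps1 * c.lyapunov A lam f flow z.x z.v := by
    rw [div_mul_eq_mul_div, le_div_iff₀ h1, mul_assoc]
    refine mul_le_mul_of_nonneg_left ?_ hm0
    linarith
  have j4 : ‖z'.x i - z.x i‖ ^ 2 ≤ α ^ 2 * (4 * (m / c.eps1 * c.lyapunov A lam f flow z.x z.v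
      + c.beta ^ 2 * c.rho ^ 2 * ‖e‖ ^ 2)) := by
    refine hmove.trans (mul_le_mul_of_nonneg_left (hdir.trans ?_) (sq_nonneg α))
    linarith
  have j5 := mul_le_mul_of_nonneg_left j4 (by positivity : 0 ≤ (1 + c.eps5⁻¹) * c.dhat ^ 2)
  refine j5.trans (le_of_eq ?_)
  rw [hen, Params.psi3, Params.psi4, ← hm]
  ring

end Run

/-! ### The joint induction along a run. -/

section Run

variable {n d : ℕ} {p : ℝ≥0∞} {c : Params} {A : Matrix (Fin n) (Fin n) ℝ} {lam α : ℝ}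
  {f : Fin n → Vec d → ℝ} {comp : Vec d → Vec d} {s : ℕ → ℝ} {x0 : Fin n → Vec d}
  {z : ℕ → State n d}

lemma State.step_eq_update (z : State n d) (hy : z.y = applyMat (laplacian A) z.xhat) (s : ℝ) :
    z.step c A α f comp s
      = z.update c α f (z.step c A α f comp s).xhat
          (applyMat (laplacian A) (z.step c A α f comp s).xhat) := by
  have h : (fun i => z.y i + (c.om * s) • applyMat (laplacian A) (z.message comp s) i)
      = applyMat (laplacian A) (fun i => z.xhat i + (c.om * s) • z.message comp s i) := by
    funext i
    simp only [hy, applyMat, smul_add, Finset.sum_add_distrib, Finset.smul_sum, smul_smul]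
    congr 1
    exact Finset.sum_congr rfl fun j _ => by rw [mul_comm]
  simp only [State.step, h]
  rfl

/-- Along a run, `y_k = L x̂_k`, and every iteration is an update with `x̂_k`. -/
lemma State.IsRunWithExactFirstRound.eq_update
    (hz : State.IsRunWithExactFirstRound c A α f comp s x0 z) (k : ℕ) :
    z (k + 1) = (z k).update c α f (z (k + 1)).xhat (applyMat (laplacian A) (z (k + 1)).xhat) := by
  induction k with
  | zero =>
    rcases hz.1 with ⟨h0, h1⟩ | ⟨-, h1⟩
    · have hy : (z 0).y = applyMat (laplacian A) (z 0).xhat := by rw [h0]; rfl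
      rw [zero_add, h1]
      exact State.step_eq_update _ hy _
    · rw [zero_add, h1]
      rfl
  | succ k ih =>
    have hy : (z (k + 1)).y = applyMat (laplacian A) (z (k + 1)).xhat := by
      conv_lhs => rw [ih]
      rfl
    rw [hz.2 (k + 1) (Nat.succ_pos k)]
    exact State.step_eq_update _ hy _

lemma State.IsRunWithExactFirstRound.initial
    (hz : State.IsRunWithExactFirstRound c A α f comp s x0 z) : (z 0).x = x0 ∧ (z 0).v = 0 := by
  rcases hz.1 with ⟨h0, -⟩ | ⟨h0, -⟩ <;> rw [h0] <;> exact ⟨rfl, rfl⟩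

lemma sum_norm_sq_le_of_lpNorm_sq_le (hp : 1 ≤ p) {b : ℝ} {e : Fin n → Vec d}
    (he : ∀ i, lpNorm p (e i) ^ 2 ≤ b) : ∑ i, ‖e i‖ ^ 2 ≤ n * dTilde p d ^ 2 * b := by
  refine (Finset.sum_le_card_nsmul _ _ (dTilde p d ^ 2 * b) fun i _ => ?_).trans
    (le_of_eq (by simp [mul_assoc]))
  have h := pow_le_pow_left₀ (norm_nonneg _) (norm_le_dTilde_mul hp (e i)) 2
  rw [mul_pow] at h
  exact h.trans (mul_le_mul_of_nonneg_left (he i) (sq_nonneg _))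

/-- The part of the Lyapunov decrease that measures stationarity and consensus. -/
def progress (c : Params) (f : Fin n → Vec d → ℝ) (x : Fin n → Vec d) : ℝ :=
  (3 / 10) * n * ‖∇ (globalCost f) (mean x)‖ ^ 2 + c.ell ^ 2 / 20 * ∑ i, ‖x i - mean x‖ ^ 2

lemma progress_nonneg (c : Params) (f : Fin n → Vec d → ℝ) (x : Fin n → Vec d) :
    0 ≤ progress c f x := by
  rw [progress]
  positivity

/-- Along the run, the Lyapunov function grows at most by the accumulated compression errors, and
the compression errors are controlled by the scaling factors. -/
theorem Params.Admissible.run_bounds (h : c.Admissible) (hp : 1 ≤ p) (hd : c.dhat = dHat p d)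
    (hA : IsConnectedNetwork A)
    (N : IsNetworkTriple (H := Stacked n d) (matOp (matE n))
      (matOp (laplacian A + lam • avgMatrix n)) (matOp (matF A lam)) c.rho2 c.rho lam)
    (hlam : c.rho2 ≤ lam) (hlam' : lam ≤ c.rho)
    (hcomp : LocallyBounded p c.C c.r c.del comp)
    (hf : ∀ i, Differentiable ℝ (f i))
    (hlip : ∀ i x y, ‖∇ (f i) x - ∇ (f i) y‖ ≤ c.ell * ‖x - y‖)
    {flow : ℝ} (hflow : ∀ x, flow ≤ globalCost f x)
    (hα : 0 ≤ α) (hα7 : α ≤ c.kappa7)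
    (hα3 : (1 - 2 * c.eps5) * c.psi3 * α ^ 2 * (n * dTilde p d ^ 2) ≤ c.eps8)
    {T : ℕ} {V0 R : ℝ} (hV0 : V0 = c.lyapunov A lam f flow x0 0)
    (hspos : ∀ k, 0 < s k) (hs0 : ∀ k, k ≤ T → s k ^ 2 ≤ s 0 ^ 2)
    (hR : R = α * c.psi2 α * (n * dTilde p d ^ 2 * (c.C ^ 2 * s 0 ^ 2 * (1 - 2 * c.eps5))))
    (hs : ∀ k, k < T → c.C ^ 2 * (1 - c.eps8) * s k ^ 2 + α ^ 2 * c.psi4 * (V0 + T * R)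
      ≤ c.C ^ 2 * s (k + 1) ^ 2)
    (hz : State.IsRunWithExactFirstRound c A α f comp s x0 z) (k : ℕ) (hk : k ≤ T) :
    mean (z k).v = 0 ∧
      c.lyapunov A lam f flow (z k).x (z k).v + α * ∑ j ∈ Finset.range k, progress c f (z j).x
        ≤ V0 + k * R ∧
      ∀ i, lpNorm p ((z k).x i - (z (k + 1)).xhat i) ^ 2
        ≤ c.C ^ 2 * s k ^ 2 * (1 - 2 * c.eps5) := by
  have hS : 0 ≤ 1 - 2 * c.eps5 := by linarith [h.eps5_le]
  have hψ2 := h.psi2_nonneg hα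
  have hR0 : 0 ≤ R := by rw [hR]; positivity
  have hstep : ∀ k, z (k + 1) = (z k).step c A α f comp (s k) →
      (∀ i, lpNorm p ((z k).x i - (z k).xhat i) ^ 2 ≤ c.C ^ 2 * s k ^ 2) →
      ∀ i, lpNorm p ((z k).x i - (z (k + 1)).xhat i) ^ 2
        ≤ c.C ^ 2 * s k ^ 2 * (1 - 2 * c.eps5) := by
    intro k hzk hin i
    have h1 := h.lpNorm_compress_sq_le hp hcomp (hspos k) (hin i)
    -- The state `z k` stores `x̂_{k-1}`, so `(z (k + 1)).xhat` is `x̂_k` and this is the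
    -- compression error of iteration `k`.
    have e1 : (z k).x i - (z (k + 1)).xhat i
        = (z k).x i - (z k).xhat i
          - (c.om * s k) • comp ((1 / s k) • ((z k).x i - (z k).xhat i)) := by
      rw [hzk, sub_sub]
      rfl
    rwa [e1]
  have hzero : lpNorm p (0 : Vec d) = 0 := by
    have := lpNorm_smul hp 0 (0 : Vec d)
    simpa using this
  induction k with
  | zero =>
    obtain ⟨hx0, hv0⟩ := hz.initial
    refine ⟨?_, ?_, ?_⟩
    · rw [hv0]; simp [mean]
    · rw [hx0, hv0, hV0]; simp
    -- The exact round starts the induction: in the warm start the first innovation vanishes, in the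
    -- other variant the first error does.
    · rcases hz.1 with ⟨h0, h1⟩ | ⟨h0, h1⟩
      · refine hstep 0 h1 fun i => ?_
        have e1 : (z 0).x i - (z 0).xhat i = 0 := by rw [h0]; exact sub_self _
        rw [e1, hzero, zero_pow two_ne_zero]
        positivity
      · intro i
        have e1 : (z 0).x i - (z (0 + 1)).xhat i = 0 := by
          rw [zero_add, h1, h0]
          exact sub_self _
        rw [e1, hzero, zero_pow two_ne_zero]
        positivity
  | succ k ih =>
    obtain ⟨hv, hV, he⟩ := ih (by omega)
    have hkT : k < T := hk
    have hupd := hz.eq_update k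
    obtain ⟨p1, p3, p5⟩ := h.mul_phi_le hα7
    have herr := sum_norm_sq_le_of_lpNorm_sq_le hp he
    have hVk : c.lyapunov A lam f flow (z k).x (z k).v ≤ V0 + T * R := by
      have k1 := mul_nonneg hα (Finset.sum_nonneg fun j (_ : j ∈ Finset.range k) =>
        progress_nonneg c f (z j).x)
      have k2 : (k : ℝ) * R ≤ T * R := by
        have : (k : ℝ) ≤ T := by exact_mod_cast hkT.le
        gcongr
      linarith
    refine ⟨?_, ?_, ?_⟩
    · rw [hupd]
      exact mean_update_v hA α f _ hv _
    · have hL := lyapunov_update_le hA N h.rho2_pos hlam hlam' h.ell_pos h.tau1_pos.le h.gam_pos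
        h.gam_mul hf hlip hα p1 p3 p5 flow (z k) hv _ _ hupd
      have k3 : α * c.psi2 α * ∑ i, ‖(z k).x i - (z (k + 1)).xhat i‖ ^ 2 ≤ R := by
        rw [hR]
        refine mul_le_mul_of_nonneg_left (herr.trans ?_) (mul_nonneg hα hψ2)
        have := hs0 k hkT.le
        gcongr
      rw [← progress] at hL
      rw [Finset.sum_range_succ]
      push_cast
      linarith
    · refine hstep (k + 1) (hz.2 (k + 1) (Nat.succ_pos k)) fun i => ?_
      -- The new innovation must lie in the ball of radius `C s_{k+1}`. The old error contributes `1
      -- - 2ε₈` times `C² s_k²`, the `psi3` term at most `ε₈`, and the `psi4` term the increment of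
      -- the recursion.
      have hmv := h.movement_le hA N hlip (α := α) (z k) (hflow _) (z (k + 1)).xhat i
      rw [← hupd] at hmv
      have hin := h.lpNorm_innovation_sq_le hp hd ((z k).x i - (z (k + 1)).xhat i)
        ((z (k + 1)).x i - (z k).x i)
      rw [sub_add_sub_cancel] at hin
      have q1 := mul_le_mul_of_nonneg_left (he i) (by linarith [h.eps5_pos] : 0 ≤ 1 + c.eps5)
      have q2 := mul_le_mul_of_nonneg_left hVk (mul_nonneg (sq_nonneg α) h.psi4_pos.le)
      have q3 := mul_le_mul_of_nonneg_left herr (mul_nonneg (sq_nonneg α) h.psi3_nonneg)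
      have q4 := mul_le_mul_of_nonneg_left hα3 (by positivity : 0 ≤ c.C ^ 2 * s k ^ 2)
      have q5 : (1 + c.eps5) * (1 - 2 * c.eps5) = 1 - 2 * c.eps8 := by
        rw [Params.eps8]; ring
      have q6 : (1 + c.eps5) * (c.C ^ 2 * s k ^ 2 * (1 - 2 * c.eps5))
          = c.C ^ 2 * s k ^ 2 * (1 - 2 * c.eps8) := by rw [← q5]; ring
      rw [q6] at q1
      have := hs k hkT
      linarith

end Run

/-- The bound on the Lyapunov function per agent. -/
def Params.level (c : Params) : ℝ := c.C ^ 2 * c.eps8 * c.tau4 / c.psi4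

/-- The constant of the convergence rate. -/
def Params.rateConst (c : Params) : ℝ :=
  1 + |c.level| + |c.level| / (min (3 / 10) (c.ell ^ 2 / 20) * c.tau0)

end CompressedOpt

end

/-! ### Choice of constants and conclusion. -/

open CompressedOpt in
theorem theorem2
    -- the hidden constant `M` depends on these scalars only
    (c : Params)
    (hell : 0 < c.ell) (hC : 0 < c.C) (hr : 0 < c.r) (hdel : 0 < c.del) (hdel1 : c.del ≤ 1)
    (hom : 0 < c.om) (hom1 : c.om ≤ 1 / c.r)
    (htau1 : c.kappa1 ≤ c.tau1) (hgam : c.kappa2 < c.gam) (hkappa : 0 < c.kappaHat0)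
    (htau0 : 0 < c.tau0) (htau4 : 0 < c.tau4) :
    ∃ M : ℝ, 0 < M ∧
      ∀ (n d : ℕ) (_ : 1 ≤ d) (p : ENNReal) (_ : 1 ≤ p) (_ : c.dhat = dHat p d)
        -- the network, its spectrum, and the eigenvalue chosen in the definition of `F`
        (A : Matrix (Fin n) (Fin n) ℝ) (_ : IsConnectedNetwork A)
        (_ : IsGreatest ((fun μ : ℝ => |μ|) '' spectrum ℝ (laplacian A)) c.rho)
        (_ : IsLeast {μ : ℝ | μ ∈ spectrum ℝ (laplacian A) ∧ 0 < μ} c.rho2)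
        (lam : ℝ) (_ : c.rho2 ≤ lam) (_ : lam ≤ c.rho)
        -- the compressor
        (comp : Vec d → Vec d) (_ : LocallyBounded p c.C c.r c.del comp)
        -- the cost functions and the known lower bound
        (f : Fin n → Vec d → ℝ) (_ : ∀ i, Differentiable ℝ (f i))
        (_ : ∀ i x y, ‖gradient (f i) x - gradient (f i) y‖ ≤ c.ell * ‖x - y‖)
        (_ : BddBelow (Set.range (globalCost f)))
        (flow : ℝ) (_ : flow ≤ ⨅ x, globalCost f x)
        -- initial point, horizon, stepsize and scaling factors
        (x0 : Fin n → Vec d) (T : ℕ) (_ : c.kappa3 n (dTilde p d) < T)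
        (α : ℝ) (_ : α = c.stepsize n (dTilde p d) T) (_ : c.Tau0LeKappa0 α)
        (V0 : ℝ) (_ : V0 = c.lyapunov A lam f flow x0 0) (_ : c.kappa4 n V0 ≤ c.tau4)
        (s : ℕ → ℝ) (_ : ∀ k, 0 < s k) (_ : s 0 ^ 2 = c.tau4 * n * α ^ 2)
        (_ : ∀ k, 1 ≤ k → k ≤ T →
          s k ^ 2 = (1 - c.eps8) * s (k - 1) ^ 2
            + c.kappaTilde4 n (dTilde p d) V0 (s 0) α T)
        -- the run of the algorithm
        (z : ℕ → State n d) (_ : State.IsRunWithExactFirstRound c A α f comp s x0 z),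
        (1 / (T : ℝ)) * ∑ k ∈ Finset.range T,
            (‖gradient (globalCost f) (mean (z k).x)‖ ^ 2
              + (1 / (n : ℝ)) * ∑ i, ‖(z k).x i - mean (z k).x‖ ^ 2)
          ≤ M * ((n : ℝ) ^ (1 / 3 : ℝ) * dTilde p d ^ (2 / 3 : ℝ) / (T : ℝ) ^ (2 / 3 : ℝ)) ∧
        globalCost f (mean (z T).x) - ⨅ x, globalCost f x ≤ M := by
  have hm0 : 0 < min (3 / 10) (c.ell ^ 2 / 20) := lt_min (by norm_num) (by positivity)
  -- The constant is fixed before any network is given, when the sign of `level` is not yet known;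
  -- the absolute values make it positive regardless.
  refine ⟨c.rateConst, by rw [Params.rateConst]; positivity, ?_⟩
  intro n d hd p hp hdhat A hA hrho hrho2 lam hlam hlam' comp hcomp f hf hlip hbdd flow hflow x0 T
    hT α hαdef hκ0 V0 hV0 hκ4 s hspos hs0 hsrec z hz
  have hrho2pos : 0 < c.rho2 := hrho2.1.2
  have hgam5 : 5 / c.rho2 < c.gam :=
    ((le_max_left _ _).trans (le_max_right _ _)).trans_lt hgam
  have adm : c.Admissible :=
    { ell_pos := hell, C_pos := hC, r_pos := hr, del_pos := hdel, del_le := hdel1, om_pos := hom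
      om_le := (le_div_iff₀ hr).1 hom1
      rho2_pos := hrho2pos
      rho2_le := hlam.trans hlam'
      tau1_mul := by
        have := (div_le_iff₀ hrho2pos).1 htau1
        linarith
      gam_pos := (by positivity : (0 : ℝ) < 5 / c.rho2).trans hgam5
      gam_mul := ((div_lt_iff₀ hrho2pos).1 hgam5).le
      dhat_pos := by rw [hdhat]; exact dHat_pos hd
      kappaHat0_pos := hkappa
      tau0_pos := htau0 }
  have hn : 0 < n := hA.pos
  have hn' : (0 : ℝ) < n := by exact_mod_cast hn
  have hdt : 0 < dTilde p d := zero_lt_one.trans_le (one_le_dTilde hd)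
  have hT0 := adm.horizon_pos hn hdt hT
  have hT' : (0 : ℝ) < T := by exact_mod_cast hT0
  have hαpos : 0 < α := by rw [hαdef]; exact stepsize_pos htau0 hn hdt hT0
  have hα7 : α ≤ c.kappa7 := by rw [hαdef]; exact adm.stepsize_le hn hdt hT
  have hα3 := adm.psi3_mul_le hn hdt hT
  have hαcube := stepsize_pow_three (c := c) hn hdt hT0
  have hαT := stepsize_mul (c := c) hn hdt hT0
  rw [← hαdef] at hα3 hαcube hαT
  have hψ4 := adm.psi4_pos
  have h8 := adm.eps8_pos
  have N := hA.isNetworkTriple (d := d) hrho hrho2 hlam hlam'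
  have hflow' : ∀ x, flow ≤ globalCost f x := fun x => hflow.trans (ciInf_le hbdd x)
  set R := α * c.psi2 α * (n * dTilde p d ^ 2 * (c.C ^ 2 * s 0 ^ 2 * (1 - 2 * c.eps5))) with hR
  -- The increment of the recursion is the displacement bound evaluated at the worst Lyapunov value
  -- `V0 + T R`.
  have hκt : c.C ^ 2 * c.kappaTilde4 n (dTilde p d) V0 (s 0) α T
      = α ^ 2 * c.psi4 * (V0 + T * R) := by
    rw [Params.kappaTilde4, hR]
    field_simp
  -- Half of `ε₈ s_0²` comes from `kappa4 ≤ tau4`, half from `τ₀ ≤ κ₀` with `α³ n d̃² T = τ₀³`. The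
  -- scalings therefore never exceed `s 0`.
  have hκt_le : c.kappaTilde4 n (dTilde p d) V0 (s 0) α T ≤ c.eps8 * s 0 ^ 2 := by
    have k1 : c.psi4 * V0 * α ^ 2 / c.C ^ 2 ≤ c.eps8 / 2 * s 0 ^ 2 := by
      rw [Params.kappa4, div_le_iff₀ (by positivity)] at hκ4
      rw [hs0, div_le_iff₀ (by positivity)]
      have := mul_le_mul_of_nonneg_left hκ4 (sq_nonneg α)
      linarith
    have k2 : (1 - 2 * c.eps5) * c.psi2 α * c.psi4 * n * dTilde p d ^ 2 * s 0 ^ 2 * α ^ 3 * T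
        ≤ c.eps8 / 2 * s 0 ^ 2 := by
      have k3 := mul_le_mul_of_nonneg_right hκ0 (sq_nonneg (s 0))
      rw [← hαcube] at k3
      linarith
    rw [Params.kappaTilde4]
    linarith
  have hsle : ∀ k, k ≤ T → s k ^ 2 ≤ s 0 ^ 2 := by
    intro k
    induction k with
    | zero => exact fun _ => le_rfl
    | succ k ih =>
      intro hk
      have k1 := hsrec (k + 1) (Nat.succ_pos k) hk
      rw [Nat.add_sub_cancel] at k1
      have k2 := mul_le_mul_of_nonneg_left (ih (by omega)) (sub_nonneg.2 adm.eps8_le)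
      linarith
  have hsstep : ∀ k, k < T → c.C ^ 2 * (1 - c.eps8) * s k ^ 2 + α ^ 2 * c.psi4 * (V0 + T * R)
      ≤ c.C ^ 2 * s (k + 1) ^ 2 := by
    intro k hk
    have k1 := hsrec (k + 1) (Nat.succ_pos k) hk
    rw [Nat.add_sub_cancel] at k1
    rw [k1, ← hκt]
    exact le_of_eq (by ring)
  -- As `s_0² = τ₄ n α²`, the factor `α²` cancels and a single `n` remains.
  have hlevel : V0 + T * R ≤ n * c.level := by
    have k1 := mul_le_mul_of_nonneg_left hκt_le (sq_nonneg c.C)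
    rw [hκt, hs0] at k1
    have k2 : α ^ 2 * c.psi4 * (n * c.level) = c.C ^ 2 * (c.eps8 * (c.tau4 * n * α ^ 2)) := by
      rw [Params.level]
      field_simp
    rw [← k2] at k1
    exact le_of_mul_le_mul_left k1 (by positivity)
  obtain ⟨-, hV, -⟩ := adm.run_bounds hp hdhat hA N hlam hlam' hcomp hf hlip hflow' hαpos.le hα7
    hα3 hV0 hspos hsle hR hsstep hz T le_rfl
  have hVlow := adm.le_lyapunov N flow (z T).x (z T).v (f := f)
  have hE : 0 ≤ c.eps1 * (‖matOp (matE n) (WithLp.toLp 2 (z T).x)‖ ^ 2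
      + ⟪dualError c f (z T).x (z T).v,
        matOp (matF A lam) (dualError c f (z T).x (z T).v)⟫_ℝ) :=
    mul_nonneg adm.eps1_pos.le (add_nonneg (sq_nonneg _) (N.inner_F_nonneg hrho2pos _))
  have hprog := mul_nonneg hαpos.le (Finset.sum_nonneg fun j (_ : j ∈ Finset.range T) =>
    progress_nonneg c f (z j).x)
  have hgap : 0 ≤ n * (globalCost f (mean (z T).x) - flow) :=
    mul_nonneg hn'.le (sub_nonneg.2 (hflow' _))
  have hB0 : 0 ≤ |c.level| := abs_nonneg _
  have hrest : 0 ≤ |c.level| / (min (3 / 10) (c.ell ^ 2 / 20) * c.tau0) := by positivity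
  constructor
  · set Q := ∑ k ∈ Finset.range T, (‖gradient (globalCost f) (mean (z k).x)‖ ^ 2
      + (1 / (n : ℝ)) * ∑ i, ‖(z k).x i - mean (z k).x‖ ^ 2) with hQ
    set b := (n : ℝ) ^ (1 / 3 : ℝ) * dTilde p d ^ (2 / 3 : ℝ) / (T : ℝ) ^ (2 / 3 : ℝ) with hb
    have hb0 : 0 ≤ b := by positivity
    set m := min (3 / 10) (c.ell ^ 2 / 20) with hm
    have hQle : m * n * Q ≤ ∑ j ∈ Finset.range T, progress c f (z j).x := by
      rw [hQ, Finset.mul_sum]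
      refine Finset.sum_le_sum fun k _ => ?_
      set D := ‖gradient (globalCost f) (mean (z k).x)‖ ^ 2
      set S := ∑ i, ‖(z k).x i - mean (z k).x‖ ^ 2
      have e1 : m * n * (D + 1 / (n : ℝ) * S) = m * (n * D) + m * S := by field_simp
      have k1 : m * (n * D) ≤ (3 / 10) * (n * D) :=
        mul_le_mul_of_nonneg_right (min_le_left _ _) (by positivity)
      have k2 : m * S ≤ c.ell ^ 2 / 20 * S :=
        mul_le_mul_of_nonneg_right (min_le_right _ _) (by positivity)
      rw [e1, progress]
      linarith
    have h1 : α * (m * n * Q) ≤ n * c.level := by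
      have := mul_le_mul_of_nonneg_left hQle hαpos.le
      linarith
    have h2 : α * m * Q ≤ |c.level| := by
      refine le_of_mul_le_mul_left ?_ hn'
      have := mul_le_mul_of_nonneg_left (le_abs_self c.level) hn'.le
      linarith
    have h3 : 1 / (T : ℝ) * Q ≤ |c.level| / (m * c.tau0) * b := by
      rw [← hαT, one_div, inv_mul_le_iff₀ hT', ← mul_le_mul_iff_right₀ (mul_pos hαpos hm0)]
      refine h2.trans (le_of_eq ?_)
      have : b ≠ 0 := by positivity
      field_simp
    refine h3.trans (mul_le_mul_of_nonneg_right ?_ hb0)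
    rw [Params.rateConst]
    linarith
  -- Nonnegativity of the energy and of the progress isolates the gap above `flow`, which dominates
  -- the gap above the infimum.
  · have h1 : n * (globalCost f (mean (z T).x) - flow) ≤ n * c.level := by linarith
    have h2 := le_of_mul_le_mul_left h1 hn'
    have h3 := le_abs_self c.level
    rw [Params.rateConst]
    linarith
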